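/- Let $\alpha\ge 1$. A state of a pair of qubits is a positive semidefinite $4\times4$ matrix $\rho$ of trace one, written in the computational basis $|00\rangle,|01\rangle,|10\rangle,|11\rangle$; a qubit observable is a Hermitian $2\times 2$ matrix $A$ with $A^2=I$. The $\alpha$-CHSH Bell value of $\rho$ under qubit observables $A_0,A_1$ (Alice) and $B_0,B_1$ (Bob) is $$S=\operatorname{Tr}\big[\rho\,(\alpha A_0\otimes B_0+\alpha A_0\otimes B_1+A_1\otimes B_0-A_1\otimes B_1)\big].$$ The concurrence is $C(\rho)=\max\{0,\mu_1-\mu_2-\mu_3-\mu_4\}$, where $\mu_1\ge\mu_2\ge\mu_3\ge\mu_4$ are the square roots of the eigenvalues of $\sqrt{\rho}\,(\sigma_y\otimes\sigma_y)\rho^*(\sigma_y\otimes\sigma_y)\sqrt{\rho}$ and $\rho^*$ is the entrywise complex conjugate. The entanglement of formation $E_{\mathrm F}(\rho)$ is the infimum of $\sum_i p_i\,H(\operatorname{Tr}_B|\psi_i\rangle\langle\psi_i|)$ over all finite decompositions $\rho=\sum_i p_i|\psi_i\rangle\langle\psi_i|$ into unit vectors with probabilities $p_i$, where $H(\tau)=-\operatorname{Tr}(\tau\log_2\tau)$.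 Let $h(p)=-p\log_2p-(1-p)\log_2(1-p)$. **Lower bounds.** For every state $\rho$ of a pair of qubits and all qubit observables $A_0,A_1,B_0,B_1$, with Bell value $S$: if $|S|\ge 2\alpha$, then $$C(\rho)\ \ge\ \sqrt{\frac{S^2}{4}-\alpha^2}\qquad\text{and}\qquad E_{\mathrm F}(\rho)\ \ge\ h\!\left(\frac12+\frac12\sqrt{1+\alpha^2-\frac{S^2}{4}}\right).$$ (If $|S|<2\alpha$, the first bound is read as $C(\rho)\ge0$.) **Attainment of the concurrence bound.** For every $S$ with $2\alpha\le S\le 2\sqrt{1+\alpha^2}$, put $$\lambda_{1}=\tfrac12+\tfrac12\sqrt{\tfrac{S^2}{4}-\alpha^2},\quad \lambda_2=\tfrac12-\tfrac12\sqrt{\tfrac{S^2}{4}-\alpha^2},\quad \lambda_3=\lambda_4=0,\quad \theta=\arctan\!\Big(\tfrac1\alpha\sqrt{\tfrac{S^2}{4}-\alpha^2}\Big).$$ Then the Bell-diagonal matrix $\rho_\lambda=\lambda_1|\Phi^+\rangle\langle\Phi^+|+\lambda_2|\Phi^-\rangle\langle\Phi^-|+\lambda_3|\Psi^+\rangle\langle\Psi^+|+\lambda_4|\Psi^-\rangle\langle\Psi^-|$,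 with $|\Phi^\pm\rangle=(|00\rangle\pm|11\rangle)/\sqrt2$ and $|\Psi^\pm\rangle=(|01\rangle\pm|10\rangle)/\sqrt2$, is a state; under the qubit observables $$A_0=\sigma_z,\quad A_1=\sigma_x,\quad B_0=\cos\theta\,\sigma_z+\sin\theta\,\sigma_x,\quad B_1=\cos\theta\,\sigma_z-\sin\theta\,\sigma_x$$ it has Bell value $S$, and $C(\rho_\lambda)=\sqrt{S^2/4-\alpha^2}$. -/

import Mathlib

namespace QubitPair

open Matrix
open scoped Kronecker ComplexOrder MatrixOrder

/-- Index set of the computational basis `|00⟩, |01⟩, |10⟩, |11⟩` of a pair of qubits; the first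
component belongs to Alice and the second one to Bob. -/
abbrev Idx : Type := Fin 2 × Fin 2

/-- A (mixed) state of a pair of qubits: a positive semidefinite matrix of trace one. -/
structure State where
  mat : Matrix Idx Idx ℂ
  posSemidef : mat.PosSemidef
  trace_one : mat.trace = 1

/-- The Pauli matrix `σx`. -/
def σx : Matrix (Fin 2) (Fin 2) ℂ := !![0, 1; 1, 0]

/-- The Pauli matrix `σy`. -/
def σy : Matrix (Fin 2) (Fin 2) ℂ := !![0, -Complex.I; Complex.I, 0]

/-- The Pauli matrix `σz`. -/
def σz : Matrix (Fin 2) (Fin 2) ℂ := !![1, 0; 0, -1]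

/-! ### The Bell test -/

/-- A `±1`-valued observable of a qubit: a Hermitian matrix that squares to the identity. -/
def IsObservable (A : Matrix (Fin 2) (Fin 2) ℂ) : Prop :=
  A.IsHermitian ∧ A * A = 1

/-- The `α`-CHSH operator
`α A₀ ⊗ B₀ + α A₀ ⊗ B₁ + A₁ ⊗ B₀ - A₁ ⊗ B₁`. -/
def chshOperator (α : ℝ) (A₀ A₁ B₀ B₁ : Matrix (Fin 2) (Fin 2) ℂ) : Matrix Idx Idx ℂ :=
  (α : ℂ) • (A₀ ⊗ₖ B₀) + (α : ℂ) • (A₀ ⊗ₖ B₁) + A₁ ⊗ₖ B₀ - A₁ ⊗ₖ B₁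

/-- The real number `S` is the `α`-CHSH Bell value of the state `ρ` under the given observables:
`S = Tr (ρ Ŝ_α)`. -/
def IsBellValue (α : ℝ) (ρ : State) (A₀ A₁ B₀ B₁ : Matrix (Fin 2) (Fin 2) ℂ) (S : ℝ) : Prop :=
  (ρ.mat * chshOperator α A₀ A₁ B₀ B₁).trace = (S : ℂ)

/-! ### Concurrence -/

/-- The spin-flipped matrix `(σy ⊗ σy) ρ* (σy ⊗ σy)`, with `ρ*` the entrywise complex conjugate. -/
def spinFlip (ρ : Matrix Idx Idx ℂ) : Matrix Idx Idx ℂ :=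
  (σy ⊗ₖ σy) * ρ.map star * (σy ⊗ₖ σy)

/-- The matrix `X(ρ) = √ρ (σy ⊗ σy) ρ* (σy ⊗ σy) √ρ`. -/
noncomputable def wootters (ρ : Matrix Idx Idx ℂ) : Matrix Idx Idx ℂ :=
  CFC.sqrt ρ * spinFlip ρ * CFC.sqrt ρ

theorem isHermitian_wootters (ρ : State) : (wootters ρ.mat).IsHermitian := by
  have hσ : (σy ⊗ₖ σy)ᴴ = σy ⊗ₖ σy := by
    rw [conjTranspose_kronecker]
    have : σyᴴ = σy := by
      ext i j
      fin_cases i <;> fin_cases j <;> simp [σy]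
    rw [this]
  have hc : (ρ.mat.map star)ᴴ = ρ.mat.map star := by
    ext i j
    simpa using congrArg star (ρ.posSemidef.isHermitian.apply i j)
  have hs : (CFC.sqrt ρ.mat)ᴴ = CFC.sqrt ρ.mat :=
    (CFC.sqrt_nonneg ρ.mat).posSemidef.isHermitian
  simp only [IsHermitian, wootters, spinFlip, conjTranspose_mul, hσ, hc, hs, Matrix.mul_assoc]

/-- `rootEigenvalue ρ i` is the `i`-th largest (`i = 0, 1, 2, 3`) of the square roots of the
eigenvalues of `X(ρ)`, counted with multiplicity. -/
noncomputable def rootEigenvalue (ρ : State) (i : Fin 4) : ℝ :=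
  √((isHermitian_wootters ρ).eigenvalues₀ (Fin.cast (by simp) i))

/-- The concurrence of a pair of qubits. -/
noncomputable def concurrence (ρ : State) : ℝ :=
  max 0 (rootEigenvalue ρ 0 - rootEigenvalue ρ 1 - rootEigenvalue ρ 2 - rootEigenvalue ρ 3)

/-! ### Entanglement of formation -/

/-- The binary entropy function `h(p) = -p log₂ p - (1 - p) log₂ (1 - p)`, in bits. -/
noncomputable def binaryEntropy (p : ℝ) : ℝ := Real.binEntropy p / Real.log 2

/-- The von Neumann entropy `-Tr (ρ log₂ ρ)`, in bits. -/
noncomputable def vonNeumannEntropy {n : Type*} [Fintype n] [DecidableEq n]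
    {ρ : Matrix n n ℂ} (hρ : ρ.IsHermitian) : ℝ :=
  (∑ i, Real.negMulLog (hρ.eigenvalues i)) / Real.log 2

/-- The projector `|ψ⟩⟨ψ|` (for a unit vector `ψ`). -/
def ketbra (ψ : Idx → ℂ) : Matrix Idx Idx ℂ := vecMulVec ψ (star ψ)

/-- The partial trace over Bob's qubit. -/
def partialTraceB (M : Matrix Idx Idx ℂ) : Matrix (Fin 2) (Fin 2) ℂ :=
  Matrix.of fun i j => ∑ k, M (i, k) (j, k)

theorem isHermitian_reduced (ψ : Idx → ℂ) : (partialTraceB (ketbra ψ)).IsHermitian := by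
  ext i j
  simp [partialTraceB, ketbra, vecMulVec_apply, mul_comm]

/-- The entropy of entanglement of the pure state `ψ`: the von Neumann entropy of its reduced
state. -/
noncomputable def pureEntanglement (ψ : Idx → ℂ) : ℝ :=
  vonNeumannEntropy (isHermitian_reduced ψ)

/-- The ensemble of the unit vectors `ψ i`, taken with probabilities `p i`, realizes `ρ`. -/
def IsPureDecomposition (ρ : State) {n : ℕ} (p : Fin n → ℝ) (ψ : Fin n → Idx → ℂ) : Prop :=
  (∀ i, 0 ≤ p i) ∧ ∑ i, p i = 1 ∧ (∀ i, star (ψ i) ⬝ᵥ ψ i = 1) ∧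
    ρ.mat = ∑ i, (p i : ℂ) • ketbra (ψ i)

/-- The entanglement of formation: the infimum, over all finite ensembles of pure states that
realize `ρ`, of the average entropy of entanglement. -/
noncomputable def entanglementOfFormation (ρ : State) : ℝ :=
  sInf {e : ℝ | ∃ (n : ℕ) (p : Fin n → ℝ) (ψ : Fin n → Idx → ℂ),
    IsPureDecomposition ρ p ψ ∧ e = ∑ i, p i * pureEntanglement (ψ i)}

/-! ### Bell-diagonal states -/

/-- The Bell vector `(|00⟩ + |11⟩)/√2`. -/
noncomputable def Φplus : Idx → ℂ :=
  ((√2 : ℝ) : ℂ)⁻¹ • (Pi.single (0, 0) 1 + Pi.single (1, 1) 1)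

/-- The Bell vector `(|00⟩ - |11⟩)/√2`. -/
noncomputable def Φminus : Idx → ℂ :=
  ((√2 : ℝ) : ℂ)⁻¹ • (Pi.single (0, 0) 1 - Pi.single (1, 1) 1)

/-- The Bell vector `(|01⟩ + |10⟩)/√2`. -/
noncomputable def Ψplus : Idx → ℂ :=
  ((√2 : ℝ) : ℂ)⁻¹ • (Pi.single (0, 1) 1 + Pi.single (1, 0) 1)

/-- The Bell vector `(|01⟩ - |10⟩)/√2`. -/
noncomputable def Ψminus : Idx → ℂ :=
  ((√2 : ℝ) : ℂ)⁻¹ • (Pi.single (0, 1) 1 - Pi.single (1, 0) 1)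

/-- The matrix
`l₁ |Φ⁺⟩⟨Φ⁺| + l₂ |Φ⁻⟩⟨Φ⁻| + l₃ |Ψ⁺⟩⟨Ψ⁺| + l₄ |Ψ⁻⟩⟨Ψ⁻|`. -/
noncomputable def bellDiagonal (l₁ l₂ l₃ l₄ : ℝ) : Matrix Idx Idx ℂ :=
  (l₁ : ℂ) • ketbra Φplus + (l₂ : ℂ) • ketbra Φminus +
    (l₃ : ℂ) • ketbra Ψplus + (l₄ : ℂ) • ketbra Ψminus

end QubitPair

/-! For one vector `v` of squared norm `N`, let `C` be the modulus of `flipForm v v`, `T` the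
correlation matrix and `r` Bob's Bloch vector, both unnormalized. Then `Tᵀ T = C² + r rᵀ` and `|r|²
= N² - C²`. The Bloch vectors of `B₀ ± B₁` are orthogonal with squared lengths adding up to `4`, so
Cauchy–Schwarz and Bessel give `S² ≤ 4 (α² N² + C²)` (`sq_chshValue_le`); observables equal to `±1`
obey the classical bound `2 α N`, which is stronger.

A mixed state reduces to this case by Wootters' theorem: it is a sum of four `|z⟩⟨z|`, each of
normalized concurrence exactly `C(ρ)` (`exists_balanced_decomposition`). The Bell value is additive
over them, so `|S| ≤ 2 √(α² + C(ρ)²)`. The balanced vectors come from a Takagi basis of the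
conjugate-linear square root of `X(ρ)`, then phases and real rotations that preserve the state.

For the entanglement of formation, every ensemble has average concurrence at least `C(ρ)`
(`concurrence_le_sum`), and the entropy of a pure state is a convex increasing function of its
concurrence, so Jensen's inequality concludes.

For attainment, spin flip fixes the given Bell-diagonal state, so `X(ρ) = ρ²` and the concurrence is
`λ₁ - λ₂ = t`. The Bell value is `2 (α cos θ + t sin θ)`, equal to `2 √(α² + t²)` at `tan θ = t /
α`. -/

namespace Matrix

/-! ### Sorted spectra -/

/-- The sorted eigenvalues of a Hermitian matrix can be read off any eigenbasis. -/
theorem IsHermitian.eigenvalues₀_eq_of_eigenbasis {n : Type*} [Fintype n] [DecidableEq n]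
    [Nonempty n] {H : Matrix n n ℂ} (hH : H.IsHermitian) {b : Fin (Fintype.card n) → n → ℂ}
    (hb : LinearIndependent ℂ b) {d : Fin (Fintype.card n) → ℝ} (hd : Antitone d)
    (h : ∀ k, H *ᵥ b k = (d k : ℂ) • b k) : hH.eigenvalues₀ = d := by
  have : Nonempty (Fin (Fintype.card n)) := ⟨⟨0, Fintype.card_pos⟩⟩
  set B := basisOfLinearIndependentOfCardEqFinrank hb (by simp) with hB
  have hdiag : LinearMap.toMatrix B B (toLin' H) = diagonal (fun k => (d k : ℂ)) := by
    ext i j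
    rw [LinearMap.toMatrix_apply]
    have : toLin' H (B j) = (d j : ℂ) • B j := by
      simpa [hB] using h j
    rw [this, map_smul, Finsupp.smul_apply, Module.Basis.repr_self, diagonal_apply]
    by_cases hij : i = j
    · subst hij; simp
    · simp [hij]
  have hchar : H.charpoly = ∏ k, (Polynomial.X - Polynomial.C (d k : ℂ)) := by
    rw [← charpoly_toLin', ← LinearMap.charpoly_toMatrix _ B, hdiag, charpoly_diagonal]
  have hroots : H.charpoly.roots = Multiset.map (fun k => (d k : ℂ)) Finset.univ.val := by
    rw [hchar, Polynomial.roots_prod _ _ (by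
      simp [Finset.prod_ne_zero_iff, Polynomial.X_sub_C_ne_zero])]
    simp
  -- Both sides are the sorted roots of the characteristic polynomial; `d` is already in decreasing
  -- order.
  rw [← List.ofFn_inj, ← hH.sort_roots_charpoly_eq_eigenvalues₀, hroots, Multiset.map_map,
    Fin.univ_val_map, Multiset.coe_sort]
  simp only [Function.comp_def, RCLike.re_to_complex,
    Complex.ofReal_re]
  apply List.mergeSort_of_pairwise
  simp_rw [decide_eq_true_eq, ← List.sortedGE_iff_pairwise]
  exact hd.sortedGE_ofFn

end Matrix

/-! ### Takagi factorization -/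

section Takagi

open Module

/-- A symmetric conjugate-linear map has a coneigenvector with nonnegative coneigenvalue. -/
theorem exists_coneigenvector {E : Type*} [NormedAddCommGroup E] [InnerProductSpace ℂ E]
    [FiniteDimensional ℂ E] [Nontrivial E] (J : E →ₗ⋆[ℂ] E)
    (hJ : ∀ x y, inner ℂ x (J y) = inner ℂ y (J x)) :
    ∃ (v : E) (s : ℝ), ‖v‖ = 1 ∧ 0 ≤ s ∧ J v = (s : ℂ) • v := by
  suffices h : ∃ (v : E) (s : ℝ), v ≠ 0 ∧ 0 ≤ s ∧ J v = (s : ℂ) • v by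
    obtain ⟨v, s, hv, hs, h⟩ := h
    refine ⟨((‖v‖⁻¹ : ℝ) : ℂ) • v, s, ?_, hs, ?_⟩
    · rw [norm_smul]; simp [hv]
    · rw [LinearMap.map_smulₛₗ, h, smul_comm, Complex.conj_ofReal]
  -- `J²` is complex-linear, so it has an eigenvector; symmetry of `J` forces its eigenvalue to be
  -- `(‖J v‖ / ‖v‖)²`.
  let J2 : E →ₗ[ℂ] E := J.comp J
  obtain ⟨c, hc⟩ := Module.End.exists_eigenvalue J2
  obtain ⟨v, hv⟩ := hc.exists_hasEigenvector
  have hv0 : v ≠ 0 := hv.2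
  have hJJ : J (J v) = c • v := hv.apply_eq_smul
  set s : ℝ := ‖J v‖ / ‖v‖ with hs
  have hvn : (‖v‖ : ℂ) ≠ 0 := by simpa using hv0
  have hcs : c = (s : ℂ) ^ 2 := by
    have h1 := hJ v (J v)
    rw [hJJ, inner_smul_right, inner_self_eq_norm_sq_to_K, inner_self_eq_norm_sq_to_K] at h1
    rw [hs]; push_cast
    rw [div_pow, eq_div_iff (pow_ne_zero 2 hvn)]
    exact h1
  -- Since `J² v = s² v`, the vector `J v + s v` works unless it is zero; then `J v = -s v`, and
  -- conjugate-linearity makes `i v` work.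
  by_cases hw : J v + (s : ℂ) • v = 0
  · refine ⟨Complex.I • v, s, by simpa using hv0, by positivity, ?_⟩
    rw [LinearMap.map_smulₛₗ, eq_neg_of_add_eq_zero_left hw, Complex.conj_I, smul_comm (s : ℂ)]
    simp
  · refine ⟨_, s, hw, by positivity, ?_⟩
    rw [map_add, LinearMap.map_smulₛₗ, hJJ, hcs, Complex.conj_ofReal, smul_add, smul_smul, pow_two,
      add_comm]

/-- Autonne–Takagi factorization: a symmetric conjugate-linear map has an orthonormal basis of
coneigenvectors with nonnegative coneigenvalues. -/
theorem exists_orthonormal_coneigenvectors (n : ℕ) :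
    ∀ {E : Type*} [NormedAddCommGroup E] [InnerProductSpace ℂ E] [FiniteDimensional ℂ E],
      finrank ℂ E = n → ∀ J : E →ₗ⋆[ℂ] E, (∀ x y, inner ℂ x (J y) = inner ℂ y (J x)) →
      ∃ (b : Fin n → E) (s : Fin n → ℝ), Orthonormal ℂ b ∧ (∀ k, 0 ≤ s k) ∧
        ∀ k, J (b k) = (s k : ℂ) • b k := by
  induction n with
  | zero =>
    intro E _ _ _ _ J _
    exact ⟨Fin.elim0, Fin.elim0, ⟨fun i => i.elim0, fun i => i.elim0⟩, fun i => i.elim0,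
      fun i => i.elim0⟩
  | succ n ih =>
    intro E _ _ _ hn J hJ
    have : Nontrivial E := nontrivial_of_finrank_eq_succ hn
    obtain ⟨v, s, hv, hs, hJv⟩ := exists_coneigenvector J hJ
    set K : Submodule ℂ E := (ℂ ∙ v)ᗮ with hK
    have hv0 : v ≠ 0 := by rintro rfl; simp at hv
    have hKn : finrank ℂ K = n := by
      have : Fact (finrank ℂ E = n + 1) := ⟨hn⟩
      exact Submodule.finrank_orthogonal_span_singleton hv0
    -- Symmetry makes the orthogonal complement of a coneigenvector invariant.
    have hmem : ∀ x : K, J x ∈ K := by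
      intro x
      refine Submodule.mem_orthogonal_singleton_iff_inner_right.2 ?_
      rw [hJ, hJv, inner_smul_right,
        Submodule.mem_orthogonal_singleton_iff_inner_left.1 x.2, mul_zero]
    let JK : K →ₗ⋆[ℂ] K := (J.comp K.subtype).codRestrict K hmem
    obtain ⟨b, t, hb, ht, hJb⟩ := ih hKn JK (fun x y => hJ x y)
    refine ⟨Fin.cons v (fun i => (b i : E)), Fin.cons s t, ⟨?_, ?_⟩, ?_, ?_⟩
    · refine Fin.cases (by simpa using hv) (fun i => ?_)
      simpa using hb.1 i
    · intro i j
      refine Fin.cases ?_ (fun i => ?_) i <;> refine Fin.cases ?_ (fun j => ?_) j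
      · simp
      · intro _
        simpa using Submodule.mem_orthogonal_singleton_iff_inner_right.1 (b j).2
      · intro _
        simpa using Submodule.mem_orthogonal_singleton_iff_inner_left.1 (b i).2
      · intro hij
        simpa using hb.2 (show i ≠ j from fun h => hij (by rw [h]))
    · exact Fin.cases (by simpa using hs) (fun i => by simpa using ht i)
    · refine Fin.cases (by simpa using hJv) (fun i => ?_)
      have h : J (b i) = (((t i : ℂ) • b i : K) : E) := congrArg Subtype.val (hJb i)
      simpa using h

end Takagi

/-! ### Rotating a family into isotropic vectors -/

section IsotropicFamily

variable {V M : Type*} [AddCommGroup V] [Module ℝ V] [AddCommGroup M] [Module ℝ M]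

/-- The cross terms of the two squares cancel, even for a nonsymmetric `β`. Rotations of pairs
therefore preserve both the represented matrix and the total of a quadratic form. -/
theorem LinearMap.apply_self_add_apply_self_rotation (β : V →ₗ[ℝ] V →ₗ[ℝ] M) {a b : ℝ}
    (hab : a ^ 2 + b ^ 2 = 1) (v w : V) :
    β (a • v + b • w) (a • v + b • w) + β (-b • v + a • w) (-b • v + a • w) =
      β v v + β w w := by
  simp only [map_add, map_smul, LinearMap.add_apply, LinearMap.smul_apply, smul_add, smul_smul]
  match_scalars <;> first | linear_combination hab | ring1

/-- In the plane spanned by two vectors on which a quadratic form takes opposite signs, some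
rotation turns the first vector into an isotropic one. -/
theorem LinearMap.exists_rotation_isotropic (Q : V →ₗ[ℝ] V →ₗ[ℝ] ℝ)
    {v w : V} (hv : 0 ≤ Q v v) (hw : Q w w ≤ 0) :
    ∃ a b : ℝ, a ^ 2 + b ^ 2 = 1 ∧ Q (a • v + b • w) (a • v + b • w) = 0 := by
  set F : ℝ → ℝ := fun t =>
    Q (Real.cos t • v + Real.sin t • w) (Real.cos t • v + Real.sin t • w)
  have hcont : Continuous F := by
    simp only [F, map_add, map_smul, LinearMap.add_apply, LinearMap.smul_apply, smul_eq_mul]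
    fun_prop
  obtain ⟨t, -, ht⟩ := intermediate_value_Icc' (by positivity : (0 : ℝ) ≤ Real.pi / 2)
    hcont.continuousOn (show (0 : ℝ) ∈ _ from by simpa [F] using ⟨hw, hv⟩)
  exact ⟨_, _, Real.cos_sq_add_sin_sq t, ht⟩

theorem Finset.sum_eq_sum_of_pair {ι N : Type*} [Fintype ι] [DecidableEq ι] [AddCommMonoid N]
    {f g : ι → N} {i j : ι} (hij : i ≠ j) (hpair : f i + f j = g i + g j)
    (h : ∀ k, k ≠ i → k ≠ j → f k = g k) : ∑ k, f k = ∑ k, g k := by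
  rw [← Finset.add_sum_erase _ f (Finset.mem_univ i), ← Finset.add_sum_erase (a := j) _ f
      (by simp [hij.symm]), ← Finset.add_sum_erase _ g (Finset.mem_univ i),
    ← Finset.add_sum_erase (a := j) _ g (by simp [hij.symm]), ← add_assoc, ← add_assoc, hpair]
  congr 1
  refine Finset.sum_congr rfl fun k hk => ?_
  simp only [Finset.mem_erase, Finset.mem_univ, and_true] at hk
  exact h k hk.2 hk.1

/-- A family of vectors of total value zero under a real quadratic form can be rotated into a
family of isotropic vectors, without changing the sum of the squares under a bilinear map. -/
theorem exists_isotropic_family {ι : Type*} [Fintype ι] [DecidableEq ι]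
    (Q : V →ₗ[ℝ] V →ₗ[ℝ] ℝ) (β : V →ₗ[ℝ] V →ₗ[ℝ] M)
    (z : ι → V) (hz : ∑ i, Q (z i) (z i) = 0) :
    ∃ w : ι → V, (∀ i, w i ∈ Submodule.span ℝ (Set.range z)) ∧ (∀ i, Q (w i) (w i) = 0) ∧
      ∑ i, β (w i) (w i) = ∑ i, β (z i) (z i) := by
  -- Induction on the number of non-isotropic vectors: each rotation mixes a positive with a
  -- negative vector and makes at least one of them isotropic.
  obtain ⟨n, hn⟩ : ∃ n, (Finset.univ.filter fun i => Q (z i) (z i) ≠ 0).card = n := ⟨_, rfl⟩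
  induction n using Nat.strong_induction_on generalizing z with
  | _ n ih =>
  by_cases hall : ∀ i, Q (z i) (z i) = 0
  · exact ⟨z, fun i => Submodule.subset_span ⟨i, rfl⟩, hall, rfl⟩
  obtain ⟨i, hi⟩ : ∃ i, 0 < Q (z i) (z i) := by
    by_contra! h
    exact hall fun i => (Finset.sum_eq_zero_iff_of_nonpos fun i _ => h i).1 hz i (Finset.mem_univ i)
  obtain ⟨j, hj⟩ : ∃ j, Q (z j) (z j) < 0 := by
    by_contra! h
    exact hall fun i => (Finset.sum_eq_zero_iff_of_nonneg fun i _ => h i).1 hz i (Finset.mem_univ i)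
  have hij : i ≠ j := by rintro rfl; linarith
  obtain ⟨a, b, hab, hQ⟩ := LinearMap.exists_rotation_isotropic Q hi.le hj.le
  set y : ι → V := Function.update (Function.update z i (a • z i + b • z j)) j
    (-b • z i + a • z j) with hy
  have hyi : y i = a • z i + b • z j := by simp [hy, hij]
  have hyj : y j = -b • z i + a • z j := by simp [hy]
  have hyk : ∀ k, k ≠ i → k ≠ j → y k = z k := fun k h1 h2 => by simp [hy, h1, h2]
  have hQsum : ∑ k, Q (y k) (y k) = ∑ k, Q (z k) (z k) :=
    Finset.sum_eq_sum_of_pair hij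
      (by rw [hyi, hyj, LinearMap.apply_self_add_apply_self_rotation Q hab])
      fun k h1 h2 => by rw [hyk k h1 h2]
  have hβsum : ∑ k, β (y k) (y k) = ∑ k, β (z k) (z k) :=
    Finset.sum_eq_sum_of_pair hij
      (by rw [hyi, hyj, LinearMap.apply_self_add_apply_self_rotation β hab])
      fun k h1 h2 => by rw [hyk k h1 h2]
  have hcard : (Finset.univ.filter fun k => Q (y k) (y k) ≠ 0).card < n := by
    rw [← hn]
    apply Finset.card_lt_card
    refine Finset.ssubset_iff_of_subset (fun k hk => ?_) |>.2 ⟨i, by simp [hi.ne'], ?_⟩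
    · simp only [Finset.mem_filter, Finset.mem_univ, true_and] at hk ⊢
      by_cases hki : k = i
      · rw [hki]; exact hi.ne'
      by_cases hkj : k = j
      · rw [hkj]; exact hj.ne
      rwa [hyk k hki hkj] at hk
    · rw [Finset.mem_filter, not_and_not_right, hyi, hQ]
      exact fun _ => rfl
  obtain ⟨w, hw, hQw, hβw⟩ := ih _ hcard y (hQsum.trans hz) rfl
  refine ⟨w, fun k => ?_, hQw, hβw.trans hβsum⟩
  refine Submodule.span_le.2 ?_ (hw k)
  have hmem : ∀ k, z k ∈ Submodule.span ℝ (Set.range z) := fun k =>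
    Submodule.subset_span ⟨k, rfl⟩
  rintro _ ⟨k, rfl⟩
  by_cases hki : k = i
  · rw [hki, hyi]
    exact add_mem (Submodule.smul_mem _ _ (hmem i)) (Submodule.smul_mem _ _ (hmem j))
  by_cases hkj : k = j
  · rw [hkj, hyj]
    exact add_mem (Submodule.smul_mem _ _ (hmem i)) (Submodule.smul_mem _ _ (hmem j))
  rw [hyk k hki hkj]
  exact hmem k

end IsotropicFamily

/-! ### Convexity of entropy as a function of concurrence -/

/-- `sinh x / x` is increasing: `x cosh x ≥ sinh x`. -/
theorem Real.sinh_le_mul_cosh {x : ℝ} (hx : 0 ≤ x) : Real.sinh x ≤ x * Real.cosh x := by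
  have hmono : MonotoneOn (fun y : ℝ => y * Real.cosh y - Real.sinh y) (Set.Ici 0) := by
    apply monotoneOn_of_deriv_nonneg (convex_Ici 0)
    · fun_prop
    · fun_prop
    · intro y hy
      rw [interior_Ici] at hy
      have : HasDerivAt (fun y : ℝ => y * Real.cosh y - Real.sinh y)
          (1 * Real.cosh y + y * Real.sinh y - Real.cosh y) y :=
        ((hasDerivAt_id y).mul (Real.hasDerivAt_cosh y)).sub (Real.hasDerivAt_sinh y)
      rw [this.deriv]
      have hs : 0 ≤ Real.sinh y := Real.sinh_nonneg_iff.2 (le_of_lt hy)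
      nlinarith [mul_nonneg (le_of_lt (Set.mem_Ioi.1 hy)) hs]
  have := hmono (Set.mem_Ici.2 le_rfl) (Set.mem_Ici.2 hx) hx
  simp only [zero_mul, Real.sinh_zero, sub_zero] at this
  linarith

theorem Real.antitoneOn_div_sinh :
    AntitoneOn (fun x : ℝ => x / Real.sinh x) (Set.Ioi 0) := by
  have hpos : ∀ y ∈ Set.Ioi (0 : ℝ), Real.sinh y ≠ 0 := fun y hy =>
    (Real.sinh_pos_iff.2 hy).ne'
  apply antitoneOn_of_deriv_nonpos (convex_Ioi 0)
  · exact ContinuousOn.div continuousOn_id Real.continuous_sinh.continuousOn hpos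
  · rw [interior_Ioi]
    exact DifferentiableOn.div differentiableOn_id Real.differentiable_sinh.differentiableOn hpos
  · intro y hy
    rw [interior_Ioi] at hy
    have : HasDerivAt (fun x : ℝ => x / Real.sinh x)
        ((1 * Real.sinh y - y * Real.cosh y) / Real.sinh y ^ 2) y :=
      (hasDerivAt_id y).div (Real.hasDerivAt_sinh y) (hpos y hy)
    rw [this.deriv]
    apply div_nonpos_of_nonpos_of_nonneg _ (sq_nonneg _)
    linarith [Real.sinh_le_mul_cosh (le_of_lt (Set.mem_Ioi.1 hy))]

/-- The entropy of entanglement, in nats, of a pure state of concurrence `c`. -/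
noncomputable def concurrenceEntropy (c : ℝ) : ℝ := Real.binEntropy (1 / 2 + 1 / 2 * √(1 - c ^ 2))

theorem continuous_concurrenceEntropy : Continuous concurrenceEntropy := by
  unfold concurrenceEntropy
  exact Real.binEntropy_continuous.comp (by fun_prop)

/-- The inverse hyperbolic secant. -/
noncomputable def arsech (c : ℝ) : ℝ := Real.log ((1 + √(1 - c ^ 2)) / c)

theorem arsech_pos {c : ℝ} (h0 : 0 < c) (h1 : c < 1) : 0 < arsech c := by
  have hs : 0 < √(1 - c ^ 2) := Real.sqrt_pos.2 (by nlinarith)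
  apply Real.log_pos
  rw [lt_div_iff₀ h0]
  linarith

theorem antitoneOn_arsech : AntitoneOn arsech (Set.Ioo 0 1) := by
  intro a ha b hb hab
  have hs : √(1 - b ^ 2) ≤ √(1 - a ^ 2) := Real.sqrt_le_sqrt (by nlinarith [ha.1])
  have hb0 := hb.1
  have ha0 := ha.1
  apply Real.log_le_log (by positivity)
  exact div_le_div₀ (by positivity) (by linarith) ha0 hab

theorem sinh_arsech {c : ℝ} (h0 : 0 < c) (h1 : c < 1) : Real.sinh (arsech c) = √(1 - c ^ 2) / c := by
  have hs : 0 < √(1 - c ^ 2) := Real.sqrt_pos.2 (by nlinarith)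
  have hsq : √(1 - c ^ 2) ^ 2 = 1 - c ^ 2 := Real.sq_sqrt (by nlinarith)
  rw [Real.sinh_eq, Real.exp_neg, arsech, Real.exp_log (by positivity)]
  field_simp
  linear_combination -hsq

/-- With `c = sech x`, the derivative `c / √(1 - c²) * log ((1 + √(1 - c²)) / c)` becomes `x / sinh
x`, whose monotonicity is easy to establish. -/
theorem hasDerivAt_concurrenceEntropy {c : ℝ} (h0 : 0 < c) (h1 : c < 1) :
    HasDerivAt concurrenceEntropy (arsech c / Real.sinh (arsech c)) c := by
  have hpos : 0 < 1 - c ^ 2 := by nlinarith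
  have hs : 0 < √(1 - c ^ 2) := Real.sqrt_pos.2 hpos
  have hsq : √(1 - c ^ 2) ^ 2 = 1 - c ^ 2 := Real.sq_sqrt hpos.le
  have hs1 : √(1 - c ^ 2) < 1 := by nlinarith
  have hin : HasDerivAt (fun c : ℝ => 1 / 2 + 1 / 2 * √(1 - c ^ 2))
      (1 / 2 * (-(2 * c) / (2 * √(1 - c ^ 2)))) c := by
    have : HasDerivAt (fun c : ℝ => 1 - c ^ 2) (-(2 * c)) c := by
      simpa using (hasDerivAt_pow 2 c).const_sub 1
    exact ((this.sqrt hpos.ne').const_mul (1 / 2)).const_add (1 / 2)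
  have hout := Real.hasDerivAt_binEntropy (p := 1 / 2 + 1 / 2 * √(1 - c ^ 2)) (by positivity)
    (by linarith)
  have h := hout.comp c hin
  refine HasDerivAt.congr_deriv h ?_
  rw [sinh_arsech h0 h1, arsech]
  set s := √(1 - c ^ 2)
  -- As `(1 - s) (1 + s) = c²`, the ratio `(1 - s) / (1 + s)` is the square of `c / (1 + s)`.
  have hlog : Real.log (1 - (1 / 2 + 1 / 2 * s)) - Real.log (1 / 2 + 1 / 2 * s) =
      -(2 * Real.log ((1 + s) / c)) := by
    rw [← Real.log_div (by linarith) (by positivity), ← Real.log_rpow (by positivity),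
      ← Real.log_inv]
    congr 1
    have : (0 : ℝ) < 1 / 2 + 1 / 2 * s := by positivity
    rw [Real.rpow_ofNat, ← inv_pow, inv_div, div_pow,
      div_eq_div_iff this.ne' (by positivity)]
    linear_combination (-(1 + s) / 2) * hsq
  rw [hlog]
  field_simp

/-- The derivative increases, being a composite of two decreasing functions: `arsech` and `x / sinh
x`. -/
theorem convexOn_concurrenceEntropy : ConvexOn ℝ (Set.Icc 0 1) concurrenceEntropy := by
  have hd : ∀ c ∈ Set.Ioo (0 : ℝ) 1,
      HasDerivAt concurrenceEntropy (arsech c / Real.sinh (arsech c)) c :=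
    fun c hc => hasDerivAt_concurrenceEntropy hc.1 hc.2
  apply MonotoneOn.convexOn_of_deriv (convex_Icc 0 1)
    continuous_concurrenceEntropy.continuousOn
  · rw [interior_Icc]
    exact fun c hc => (hd c hc).differentiableAt.differentiableWithinAt
  · rw [interior_Icc]
    intro a ha b hb hab
    rw [(hd a ha).deriv, (hd b hb).deriv]
    exact Real.antitoneOn_div_sinh (arsech_pos hb.1 hb.2) (arsech_pos ha.1 ha.2)
      (antitoneOn_arsech ha hb hab)

theorem monotoneOn_concurrenceEntropy : MonotoneOn concurrenceEntropy (Set.Icc 0 1) := by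
  intro a ha b hb hab
  have hs : √(1 - b ^ 2) ≤ √(1 - a ^ 2) := Real.sqrt_le_sqrt (by nlinarith [ha.1])
  have h1 : √(1 - a ^ 2) ≤ 1 := Real.sqrt_le_one.2 (by nlinarith)
  have h0 : 0 ≤ √(1 - b ^ 2) := Real.sqrt_nonneg _
  have h0' : 0 ≤ √(1 - a ^ 2) := Real.sqrt_nonneg _
  apply Real.binEntropy_strictAntiOn.antitoneOn
  · constructor <;> linarith
  · constructor <;> linarith
  · linarith

/-! ### Flip form, correlations and qubit observables -/

namespace QubitPair
open Matrix
open scoped Kronecker ComplexOrder MatrixOrder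

/-- The bilinear form `vᵀ (σy ⊗ σy) w`, whose value at `v = w` has modulus the concurrence. -/
noncomputable def flipForm (v w : Idx → ℂ) : ℂ := v ⬝ᵥ ((σy ⊗ₖ σy) *ᵥ w)

theorem flipForm_apply (v w : Idx → ℂ) :
    flipForm v w = v (0, 1) * w (1, 0) + v (1, 0) * w (0, 1) - v (0, 0) * w (1, 1) -
      v (1, 1) * w (0, 0) := by
  simp [flipForm, σy, dotProduct, mulVec, Fintype.sum_prod_type, Fin.sum_univ_two,
    kroneckerMap_apply]
  ring

/-- The unnormalized expectation `⟨v|A ⊗ B|v⟩`. -/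
noncomputable def corr (v : Idx → ℂ) (A B : Matrix (Fin 2) (Fin 2) ℂ) : ℝ :=
  (star v ⬝ᵥ ((A ⊗ₖ B) *ᵥ v)).re

theorem corr_add_left (v : Idx → ℂ) (A A' B) : corr v (A + A') B = corr v A B + corr v A' B := by
  simp [corr, add_kronecker, add_mulVec, dotProduct_add]

theorem corr_add_right (v : Idx → ℂ) (A B B') : corr v A (B + B') = corr v A B + corr v A B' := by
  simp [corr, kronecker_add, add_mulVec, dotProduct_add]

theorem corr_smul_left (v : Idx → ℂ) (r : ℝ) (A B) : corr v ((r : ℂ) • A) B = r * corr v A B := by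
  simp [corr, smul_kronecker, smul_mulVec]

theorem corr_smul_right (v : Idx → ℂ) (r : ℝ) (A B) : corr v A ((r : ℂ) • B) = r * corr v A B := by
  simp [corr, kronecker_smul, smul_mulVec]

/-- The observable with Bloch vector `(x, y, z)`. -/
noncomputable def bloch (a : Fin 3 → ℝ) : Matrix (Fin 2) (Fin 2) ℂ :=
  (a 0 : ℂ) • σx + (a 1 : ℂ) • σy + (a 2 : ℂ) • σz

/-- A qubit observable is `1`, `-1`, or has a unit Bloch vector. -/
theorem IsObservable.eq_one_or_bloch {A : Matrix (Fin 2) (Fin 2) ℂ} (hA : IsObservable A) :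
    (∃ s : ℝ, (s = 1 ∨ s = -1) ∧ A = (s : ℂ) • 1) ∨
      ∃ a : Fin 3 → ℝ, a 0 ^ 2 + a 1 ^ 2 + a 2 ^ 2 = 1 ∧ A = bloch a := by
  obtain ⟨hH, hsq⟩ := hA
  have h00 := congrArg Complex.im (hH.apply 0 0)
  have h11 := congrArg Complex.im (hH.apply 1 1)
  have h10 := hH.apply 0 1
  have h10r := congrArg Complex.re h10
  have h10i := congrArg Complex.im h10
  have s00 := congrFun (congrFun hsq 0) 0
  have s01 := congrFun (congrFun hsq 0) 1
  have s11 := congrFun (congrFun hsq 1) 1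
  have s00r := congrArg Complex.re s00
  have s01r := congrArg Complex.re s01
  have s01i := congrArg Complex.im s01
  have s11r := congrArg Complex.re s11
  simp [Matrix.mul_apply, Fin.sum_univ_two] at h00 h11 h10r h10i s00r s01r s01i s11r
  set p := (A 0 0).re
  set q := (A 1 1).re
  set x := (A 0 1).re
  set y := (A 0 1).im
  have e00 : (A 0 0).im = 0 := by linarith
  have e11 : (A 1 1).im = 0 := by linarith
  have e10i : (A 1 0).im = -y := by linarith
  rw [e00, h10r, e10i] at s00r
  rw [e11, h10r, e10i] at s11r
  rw [e00, e11] at s01r s01i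
  -- The off-diagonal entry of `A² = 1` reads `(x + i y) (p + q) = 0`: either `A` is traceless, or
  -- it is diagonal and then scalar.
  by_cases hpq : p + q = 0
  · right
    refine ⟨![x, -y, p], by simp; linarith, ?_⟩
    ext i j
    fin_cases i <;> fin_cases j <;> apply Complex.ext <;> simp [bloch, σx, σy, σz] <;> linarith
  · left
    have hx : x = 0 := by
      have : x * (p + q) = 0 := by linarith
      exact (mul_eq_zero.1 this).resolve_right hpq
    have hy : y = 0 := by
      have : y * (p + q) = 0 := by linarith
      exact (mul_eq_zero.1 this).resolve_right hpq
    have hp : p = q := by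
      have : (p - q) * (p + q) = 0 := by linarith
      linarith [(mul_eq_zero.1 this).resolve_right hpq]
    refine ⟨p, sq_eq_sq_iff_eq_or_eq_neg.1 (by rw [hx, hy] at s00r; linarith), ?_⟩
    ext i j
    fin_cases i <;> fin_cases j <;> apply Complex.ext <;> simp <;> linarith


theorem corr_bloch_left (v : Idx → ℂ) (a : Fin 3 → ℝ) (B) :
    corr v (bloch a) B = a 0 * corr v σx B + a 1 * corr v σy B + a 2 * corr v σz B := by
  simp only [bloch, corr_add_left, corr_smul_left]

theorem corr_bloch_right (v : Idx → ℂ) (b : Fin 3 → ℝ) (A) :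
    corr v A (bloch b) = b 0 * corr v A σx + b 1 * corr v A σy + b 2 * corr v A σz := by
  simp only [bloch, corr_add_right, corr_smul_right]

/-- The correlation matrix `T` of a pure state satisfies `Tᵀ T = C² + r rᵀ`, with `C` the
concurrence and `r` the Bloch vector of Bob. -/
theorem sum_sq_corr_bloch (v : Idx → ℂ) (b : Fin 3 → ℝ) :
    corr v σx (bloch b) ^ 2 + corr v σy (bloch b) ^ 2 + corr v σz (bloch b) ^ 2 =
      Complex.normSq (flipForm v v) * (b 0 ^ 2 + b 1 ^ 2 + b 2 ^ 2) + corr v 1 (bloch b) ^ 2 := by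
  rw [flipForm_apply]
  unfold corr bloch
  simp [σx, σy, σz, dotProduct, mulVec, Fintype.sum_prod_type, Fin.sum_univ_two,
    kroneckerMap_apply, Complex.normSq_apply]
  ring

/-- The Bloch vector of Bob, in terms of the concurrence. -/
theorem sum_sq_corr_one (v : Idx → ℂ) :
    corr v 1 σx ^ 2 + corr v 1 σy ^ 2 + corr v 1 σz ^ 2 =
      corr v 1 1 ^ 2 - Complex.normSq (flipForm v v) := by
  rw [flipForm_apply]
  unfold corr
  simp [σx, σy, σz, dotProduct, mulVec, Fintype.sum_prod_type, Fin.sum_univ_two,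
    kroneckerMap_apply, Complex.normSq_apply]
  ring

theorem corr_one_one (v : Idx → ℂ) : corr v 1 1 = (star v ⬝ᵥ v).re := by
  simp [corr]

theorem corr_one_one_nonneg (v : Idx → ℂ) : 0 ≤ corr v 1 1 := by
  rw [corr_one_one]
  exact (Complex.le_def.1 (dotProduct_star_self_nonneg v)).1.trans_eq (by simp)

/-! ### The classical bound for scalar observables -/

theorem IsObservable.posSemidef_one_add {A : Matrix (Fin 2) (Fin 2) ℂ} (hA : IsObservable A) :
    (1 + A).PosSemidef := by
  have h : 1 + A = (2⁻¹ : ℝ) • ((1 + A)ᴴ * (1 + A)) := by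
    rw [conjTranspose_add, conjTranspose_one, hA.1.eq, mul_add, add_mul, add_mul, hA.2, one_mul, one_mul, mul_one]
    module
  rw [h]
  exact (posSemidef_conjTranspose_mul_self _).smul (by norm_num)

theorem IsObservable.neg {A : Matrix (Fin 2) (Fin 2) ℂ} (hA : IsObservable A) :
    IsObservable (-A) := ⟨hA.1.neg, by rw [neg_mul_neg, hA.2]⟩

theorem corr_neg_left (v : Idx → ℂ) (A B) : corr v (-A) B = -corr v A B := by
  simpa using corr_smul_left v (-1) A B

theorem corr_neg_right (v : Idx → ℂ) (A B) : corr v A (-B) = -corr v A B := by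
  simpa using corr_smul_right v (-1) A B

/-- `(1 + A) ⊗ (1 + B)` is four times the projector onto the joint outcome `(+1, +1)`; replacing
`A`, `B` by their negatives covers the other outcomes. -/
theorem corr_outcome_nonneg (v : Idx → ℂ) {A B : Matrix (Fin 2) (Fin 2) ℂ} (hA : IsObservable A)
    (hB : IsObservable B) : 0 ≤ corr v 1 1 + corr v A 1 + corr v 1 B + corr v A B := by
  have h := (hA.posSemidef_one_add.kronecker hB.posSemidef_one_add).re_dotProduct_nonneg v
  have h' : 0 ≤ corr v (1 + A) (1 + B) := h
  rw [corr_add_left, corr_add_right, corr_add_right] at h'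
  linarith

theorem abs_corr_marginals_add_le (v : Idx → ℂ) {A B : Matrix (Fin 2) (Fin 2) ℂ}
    (hA : IsObservable A) (hB : IsObservable B) :
    |corr v A 1 + corr v 1 B| ≤ corr v 1 1 + corr v A B := by
  have h1 := corr_outcome_nonneg v hA hB
  have h2 := corr_outcome_nonneg v hA.neg hB.neg
  rw [corr_neg_left, corr_neg_right, corr_neg_left, corr_neg_right] at h2
  exact abs_le.2 ⟨by linarith, by linarith⟩

theorem abs_corr_marginals_sub_le (v : Idx → ℂ) {A B : Matrix (Fin 2) (Fin 2) ℂ}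
    (hA : IsObservable A) (hB : IsObservable B) :
    |corr v A 1 - corr v 1 B| ≤ corr v 1 1 - corr v A B := by
  have h := abs_corr_marginals_add_le v hA hB.neg
  rwa [corr_neg_right, corr_neg_right, ← sub_eq_add_neg, ← sub_eq_add_neg] at h

/-- The unnormalized `α`-CHSH value of a vector. -/
noncomputable def chshValue (α : ℝ) (v : Idx → ℂ) (A₀ A₁ B₀ B₁ : Matrix (Fin 2) (Fin 2) ℂ) : ℝ :=
  α * corr v A₀ B₀ + α * corr v A₀ B₁ + corr v A₁ B₀ - corr v A₁ B₁

/-- With one trivial observable for Alice, positivity of the joint outcome probabilities is enough.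
The weight `1` part of the value is at most `2 N` by `key`, and the remaining weight `α - 1`
contributes at most `2 (α - 1) N` by `bound`. -/
theorem abs_chshValue_le_of_left_scalar {α : ℝ} (hα : 1 ≤ α) (v : Idx → ℂ)
    {A₀ A₁ B₀ B₁ : Matrix (Fin 2) (Fin 2) ℂ} {s : ℝ} (hs : s = 1 ∨ s = -1)
    (hA₀ : IsObservable A₀) (hA₁ : IsObservable A₁) (hB₀ : IsObservable B₀)
    (hB₁ : IsObservable B₁) (h : A₀ = (s : ℂ) • 1 ∨ A₁ = (s : ℂ) • 1) :
    |chshValue α v A₀ A₁ B₀ B₁| ≤ 2 * α * corr v 1 1 := by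
  have hN := corr_one_one_nonneg v
  have h1 : IsObservable 1 := ⟨isHermitian_one, one_mul 1⟩
  have key : ∀ {A B₀ B₁ : Matrix (Fin 2) (Fin 2) ℂ}, IsObservable A → IsObservable B₀ →
      IsObservable B₁ → |corr v A B₀ + corr v 1 B₀| ≤ corr v 1 1 + corr v A 1 ∧
        |corr v A B₁ - corr v 1 B₁| ≤ corr v 1 1 - corr v A 1 := by
    intro A B₀ B₁ hA h0 h1'
    have a1 := abs_le.1 (abs_corr_marginals_add_le v hA h0)
    have a2 := abs_le.1 (abs_corr_marginals_sub_le v hA h0)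
    have a3 := abs_le.1 (abs_corr_marginals_add_le v hA h1')
    have a4 := abs_le.1 (abs_corr_marginals_sub_le v hA h1')
    exact ⟨abs_le.2 ⟨by linarith, by linarith⟩, abs_le.2 ⟨by linarith, by linarith⟩⟩
  have bound : ∀ {A B : Matrix (Fin 2) (Fin 2) ℂ}, IsObservable A → IsObservable B →
      |(α - 1) * corr v A B| ≤ (α - 1) * corr v 1 1 := by
    intro A B hA hB
    rw [abs_mul, abs_of_nonneg (by linarith)]
    have a1 := abs_nonneg (corr v A 1 + corr v 1 B)
    have a2 := abs_nonneg (corr v A 1 - corr v 1 B)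
    have := abs_corr_marginals_add_le v hA hB
    have := abs_corr_marginals_sub_le v hA hB
    exact mul_le_mul_of_nonneg_left (abs_le.2 ⟨by linarith, by linarith⟩) (by linarith)
  unfold chshValue
  rcases h with rfl | rfl
  · have b0 := abs_le.1 (bound h1 hB₀)
    have b1 := abs_le.1 (bound h1 hB₁)
    obtain ⟨c0, c1⟩ := key hA₁ hB₀ hB₁
    obtain ⟨d0, d1⟩ := key hA₁ hB₁ hB₀
    rw [abs_le] at c0 c1 d0 d1
    simp only [corr_smul_left]
    rw [abs_le]
    rcases hs with rfl | rfl <;> constructor <;> linarith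
  · have b0 := abs_le.1 (bound hA₀ hB₀)
    have b1 := abs_le.1 (bound hA₀ hB₁)
    obtain ⟨c0, c1⟩ := key hA₀ hB₀ hB₁
    obtain ⟨d0, d1⟩ := key hA₀ hB₁ hB₀
    rw [abs_le] at c0 c1 d0 d1
    simp only [corr_smul_left]
    rw [abs_le]
    rcases hs with rfl | rfl <;> constructor <;> linarith

theorem abs_chshValue_le_of_right_scalar {α : ℝ} (hα : 1 ≤ α) (v : Idx → ℂ)
    {A₀ A₁ B₀ B₁ : Matrix (Fin 2) (Fin 2) ℂ} {s : ℝ} (hs : s = 1 ∨ s = -1)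
    (hA₀ : IsObservable A₀) (hA₁ : IsObservable A₁) (hB₀ : IsObservable B₀)
    (hB₁ : IsObservable B₁) (h : B₀ = (s : ℂ) • 1 ∨ B₁ = (s : ℂ) • 1) :
    |chshValue α v A₀ A₁ B₀ B₁| ≤ 2 * α * corr v 1 1 := by
  have hN := corr_one_one_nonneg v
  have h1 : IsObservable 1 := ⟨isHermitian_one, one_mul 1⟩
  -- The three bounds are to be added: their terms in `t * corr v 1 B` cancel and leave `(α + 1) N +
  -- (α - 1) N = 2 α N`.
  have key : ∀ {B : Matrix (Fin 2) (Fin 2) ℂ}, IsObservable B → ∀ t : ℝ, t = 1 ∨ t = -1 →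
      |α * (corr v A₀ 1 + t * corr v A₀ B)| ≤ α * (corr v 1 1 + t * corr v 1 B) ∧
        |corr v A₁ 1 - t * corr v A₁ B| ≤ corr v 1 1 - t * corr v 1 B ∧
        |(α - 1) * (t * corr v 1 B)| ≤ (α - 1) * corr v 1 1 := by
    intro B hB t ht
    have ht' : |t| = 1 := by rcases ht with rfl | rfl <;> simp
    rw [abs_mul, abs_mul (α - 1), abs_of_nonneg (by linarith : 0 ≤ α),
      abs_of_nonneg (by linarith : 0 ≤ α - 1)]
    have a1 := abs_le.1 (abs_corr_marginals_add_le v hA₀ hB)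
    have a2 := abs_le.1 (abs_corr_marginals_sub_le v hA₀ hB)
    have a3 := abs_le.1 (abs_corr_marginals_add_le v hA₁ hB)
    have a4 := abs_le.1 (abs_corr_marginals_sub_le v hA₁ hB)
    refine ⟨mul_le_mul_of_nonneg_left ?_ (by linarith), ?_,
      mul_le_mul_of_nonneg_left ?_ (by linarith)⟩ <;>
    rw [abs_le] <;> rcases ht with rfl | rfl <;> constructor <;> linarith
  unfold chshValue
  rcases h with rfl | rfl
  · simp only [corr_smul_right]
    obtain ⟨c0, c1, c2⟩ := key hB₁ s hs
    rw [abs_le] at *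
    rcases hs with rfl | rfl <;> constructor <;> linarith
  · simp only [corr_smul_right]
    obtain ⟨c0, c1, c2⟩ := key hB₀ s hs
    rw [abs_le] at *
    rcases hs with rfl | rfl <;> constructor <;> linarith

/-! ### The CHSH bound for pure states -/

theorem sq_dot_le {a u : Fin 3 → ℝ} (ha : a 0 ^ 2 + a 1 ^ 2 + a 2 ^ 2 = 1) :
    (a 0 * u 0 + a 1 * u 1 + a 2 * u 2) ^ 2 ≤ u 0 ^ 2 + u 1 ^ 2 + u 2 ^ 2 := by
  have h : u 0 ^ 2 + u 1 ^ 2 + u 2 ^ 2 - (a 0 * u 0 + a 1 * u 1 + a 2 * u 2) ^ 2 =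
      (a 0 * u 1 - a 1 * u 0) ^ 2 + (a 0 * u 2 - a 2 * u 0) ^ 2 + (a 1 * u 2 - a 2 * u 1) ^ 2 := by
    linear_combination -(u 0 ^ 2 + u 1 ^ 2 + u 2 ^ 2) * ha
  nlinarith [sq_nonneg (a 0 * u 1 - a 1 * u 0), sq_nonneg (a 0 * u 2 - a 2 * u 0),
    sq_nonneg (a 1 * u 2 - a 2 * u 1)]

/-- Bessel's inequality for two orthogonal vectors of `ℝ³`, not normalized. -/
theorem bessel_of_orthogonal (r p m : Fin 3 → ℝ) (h : p 0 * m 0 + p 1 * m 1 + p 2 * m 2 = 0) :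
    (r 0 * p 0 + r 1 * p 1 + r 2 * p 2) ^ 2 * (m 0 ^ 2 + m 1 ^ 2 + m 2 ^ 2) +
      (r 0 * m 0 + r 1 * m 1 + r 2 * m 2) ^ 2 * (p 0 ^ 2 + p 1 ^ 2 + p 2 ^ 2) ≤
      (r 0 ^ 2 + r 1 ^ 2 + r 2 ^ 2) * (p 0 ^ 2 + p 1 ^ 2 + p 2 ^ 2) *
        (m 0 ^ 2 + m 1 ^ 2 + m 2 ^ 2) := by
  -- The squared determinant of `r`, `p`, `m` is their Gram determinant, simplified by `p ⬝ m = 0`.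
  have hdet := sq_nonneg (r 0 * (p 1 * m 2 - p 2 * m 1) - r 1 * (p 0 * m 2 - p 2 * m 0) +
    r 2 * (p 0 * m 1 - p 1 * m 0))
  have key : (r 0 * (p 1 * m 2 - p 2 * m 1) - r 1 * (p 0 * m 2 - p 2 * m 0) +
      r 2 * (p 0 * m 1 - p 1 * m 0)) ^ 2 =
      (r 0 ^ 2 + r 1 ^ 2 + r 2 ^ 2) * (p 0 ^ 2 + p 1 ^ 2 + p 2 ^ 2) *
        (m 0 ^ 2 + m 1 ^ 2 + m 2 ^ 2) -
      (r 0 * p 0 + r 1 * p 1 + r 2 * p 2) ^ 2 * (m 0 ^ 2 + m 1 ^ 2 + m 2 ^ 2) -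
      (r 0 * m 0 + r 1 * m 1 + r 2 * m 2) ^ 2 * (p 0 ^ 2 + p 1 ^ 2 + p 2 ^ 2) := by
    linear_combination (2 * (r 0 * p 0 + r 1 * p 1 + r 2 * p 2) *
      (r 0 * m 0 + r 1 * m 1 + r 2 * m 2) - (r 0 ^ 2 + r 1 ^ 2 + r 2 ^ 2) *
      (p 0 * m 0 + p 1 * m 1 + p 2 * m 2)) * h
  linarith

/-- Here `P`, `M` stand for the squared lengths of the Bloch vectors of `B₀ ± B₁`, `f`, `g` for
their products with Bob's Bloch vector, `K` for `C²` and `R` for `|r|²`. Cauchy–Schwarz gives `(α u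
+ w)² ≤ (P + M) (α² u² / P + w² / M)`, and Bessel gives `f² / P + g² / M ≤ R`; `α ≥ 1` lets `α² R`
absorb both contributions. The cases `P = 0` and `M = 0` are separate because of the divisions. -/
theorem sq_mul_add_le {α u w P M f g K R : ℝ} (hα : 1 ≤ α) (hP : 0 ≤ P) (hM : 0 ≤ M)
    (hPM : P + M = 4) (hK : 0 ≤ K) (hR : 0 ≤ R) (hu : u ^ 2 ≤ K * P + f ^ 2)
    (hw : w ^ 2 ≤ K * M + g ^ 2) (hf : f ^ 2 ≤ R * P) (hg : g ^ 2 ≤ R * M)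
    (hfg : f ^ 2 * M + g ^ 2 * P ≤ R * P * M) :
    (α * u + w) ^ 2 ≤ 4 * (α ^ 2 * (K + R) + K) := by
  have hα2 : 1 ≤ α ^ 2 := by nlinarith
  rcases hP.eq_or_lt with rfl | hP
  · have hu0 : u = 0 := by nlinarith [sq_nonneg u]
    have : M = 4 := by linarith
    subst this
    rw [hu0]
    nlinarith [mul_nonneg (by linarith : 0 ≤ α ^ 2 - 1) (add_nonneg hK hR)]
  rcases hM.eq_or_lt with rfl | hM
  · have hw0 : w = 0 := by nlinarith [sq_nonneg w]
    have : P = 4 := by linarith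
    subst this
    rw [hw0, add_zero, mul_pow]
    nlinarith [mul_le_mul_of_nonneg_left (hu.trans (add_le_add_right hf _)) (sq_nonneg α)]
  have hcs : (α * u + w) ^ 2 * (P * M) ≤ 4 * (α ^ 2 * u ^ 2 * M + w ^ 2 * P) := by
    rw [← hPM]
    nlinarith [sq_nonneg (α * u * M - w * P)]
  have h1 : α ^ 2 * u ^ 2 * M + w ^ 2 * P ≤ (α ^ 2 * (K + R) + K) * (P * M) := by
    have e1 := mul_le_mul_of_nonneg_right hu hM.le
    have e2 := mul_le_mul_of_nonneg_right hw hP.le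
    have e3 := mul_le_mul_of_nonneg_right hf hM.le
    have e4 := mul_le_mul_of_nonneg_left (e1.trans
      (by linarith : (K * P + f ^ 2) * M ≤ K * P * M + R * P * M))
      (by linarith : 0 ≤ α ^ 2 - 1)
    linarith
  have h2 : (α * u + w) ^ 2 * (P * M) ≤ 4 * (α ^ 2 * (K + R) + K) * (P * M) := by linarith
  exact le_of_mul_le_mul_right h2 (mul_pos hP hM)

/-- The `α`-CHSH value of a pure state is at most `2 √(α² + C²)`, with `C` its concurrence. -/
theorem sq_chshValue_le {α : ℝ} (hα : 1 ≤ α) (v : Idx → ℂ)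
    {A₀ A₁ B₀ B₁ : Matrix (Fin 2) (Fin 2) ℂ} (hA₀ : IsObservable A₀) (hA₁ : IsObservable A₁)
    (hB₀ : IsObservable B₀) (hB₁ : IsObservable B₁) :
    chshValue α v A₀ A₁ B₀ B₁ ^ 2 ≤
      4 * (α ^ 2 * corr v 1 1 ^ 2 + Complex.normSq (flipForm v v)) := by
  have hC := Complex.normSq_nonneg (flipForm v v)
  have hN := corr_one_one_nonneg v
  have weak : |chshValue α v A₀ A₁ B₀ B₁| ≤ 2 * α * corr v 1 1 →
      chshValue α v A₀ A₁ B₀ B₁ ^ 2 ≤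
        4 * (α ^ 2 * corr v 1 1 ^ 2 + Complex.normSq (flipForm v v)) := by
    intro h
    have := pow_le_pow_left₀ (abs_nonneg _) h 2
    rw [sq_abs] at this
    linarith
  rcases hA₀.eq_one_or_bloch with ⟨s, hs, h⟩ | ⟨a₀, ha₀, eA₀⟩
  · exact weak (abs_chshValue_le_of_left_scalar hα v hs hA₀ hA₁ hB₀ hB₁
      (Or.inl h))
  rcases hA₁.eq_one_or_bloch with ⟨s, hs, h⟩ | ⟨a₁, ha₁, eA₁⟩
  · exact weak (abs_chshValue_le_of_left_scalar hα v hs hA₀ hA₁ hB₀ hB₁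
      (Or.inr h))
  rcases hB₀.eq_one_or_bloch with ⟨s, hs, h⟩ | ⟨b₀, hb₀, eB₀⟩
  · exact weak (abs_chshValue_le_of_right_scalar hα v hs hA₀ hA₁ hB₀ hB₁
      (Or.inl h))
  rcases hB₁.eq_one_or_bloch with ⟨s, hs, h⟩ | ⟨b₁, hb₁, eB₁⟩
  · exact weak (abs_chshValue_le_of_right_scalar hα v hs hA₀ hA₁ hB₀ hB₁
      (Or.inr h))
  set p : Fin 3 → ℝ := b₀ + b₁ with hp
  set m : Fin 3 → ℝ := b₀ - b₁ with hm
  have hS : chshValue α v A₀ A₁ B₀ B₁ = α * corr v A₀ (bloch p) + corr v A₁ (bloch m) := by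
    rw [chshValue, eB₀, eB₁]
    simp only [corr_bloch_right, hp, hm, Pi.add_apply, Pi.sub_apply]
    ring
  have hcorr : ∀ (a b : Fin 3 → ℝ), a 0 ^ 2 + a 1 ^ 2 + a 2 ^ 2 = 1 →
      corr v (bloch a) (bloch b) ^ 2 ≤
        Complex.normSq (flipForm v v) * (b 0 ^ 2 + b 1 ^ 2 + b 2 ^ 2) +
          corr v 1 (bloch b) ^ 2 := by
    intro a b ha
    rw [corr_bloch_left, ← sum_sq_corr_bloch]
    exact sq_dot_le (u := ![corr v σx (bloch b), corr v σy (bloch b), corr v σz (bloch b)]) ha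
  set r : Fin 3 → ℝ := ![corr v 1 σx, corr v 1 σy, corr v 1 σz] with hr
  have hr1 : ∀ b, corr v 1 (bloch b) = r 0 * b 0 + r 1 * b 1 + r 2 * b 2 := by
    intro b
    rw [corr_bloch_right, hr]
    simp only [cons_val]
    ring
  have hr2 : r 0 ^ 2 + r 1 ^ 2 + r 2 ^ 2 = corr v 1 1 ^ 2 - Complex.normSq (flipForm v v) :=
    sum_sq_corr_one v
  have hcs : ∀ b : Fin 3 → ℝ, corr v 1 (bloch b) ^ 2 ≤
      (r 0 ^ 2 + r 1 ^ 2 + r 2 ^ 2) * (b 0 ^ 2 + b 1 ^ 2 + b 2 ^ 2) := by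
    intro b
    rw [hr1]
    nlinarith [sq_nonneg (r 0 * b 1 - r 1 * b 0), sq_nonneg (r 0 * b 2 - r 2 * b 0),
      sq_nonneg (r 1 * b 2 - r 2 * b 1)]
  have hpm : p 0 * m 0 + p 1 * m 1 + p 2 * m 2 = 0 := by
    simp only [hp, hm, Pi.add_apply, Pi.sub_apply]
    linear_combination hb₀ - hb₁
  have hfg := bessel_of_orthogonal r p m hpm
  rw [← hr1, ← hr1] at hfg
  have := sq_mul_add_le hα (by positivity) (by positivity)
    (by simp only [hp, hm, Pi.add_apply, Pi.sub_apply]; linear_combination 2 * hb₀ + 2 * hb₁)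
    hC (by positivity) (hcorr a₀ p ha₀) (hcorr a₁ m ha₁) (hcs p) (hcs m) hfg
  rw [hS, eA₀, eA₁]
  rw [hr2] at this
  linarith

/-! ### Wootters' decomposition and average concurrence -/

theorem flipForm_comm (v w : Idx → ℂ) : flipForm v w = flipForm w v := by
  rw [flipForm_apply, flipForm_apply]; ring

theorem flipForm_star (v w : Idx → ℂ) : flipForm (star v) (star w) = star (flipForm v w) := by
  simp [flipForm_apply]

/-- `flipForm` as a bilinear map. -/
noncomputable def flipBilin : (Idx → ℂ) →ₗ[ℂ] (Idx → ℂ) →ₗ[ℂ] ℂ :=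
  LinearMap.mk₂ ℂ flipForm
    (fun _ _ _ => by simp only [flipForm_apply, Pi.add_apply]; ring)
    (fun _ _ _ => by simp only [flipForm_apply, Pi.smul_apply, smul_eq_mul]; ring)
    (fun _ _ _ => by simp only [flipForm_apply, Pi.add_apply]; ring)
    (fun _ _ _ => by simp only [flipForm_apply, Pi.smul_apply, smul_eq_mul]; ring)

theorem flipBilin_apply (v w : Idx → ℂ) : flipBilin v w = flipForm v w := rfl

theorem flipForm_smul_smul (a b : ℂ) (v w : Idx → ℂ) :
    flipForm (a • v) (b • w) = a * b * flipForm v w := by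
  simp only [← flipBilin_apply, map_smul, LinearMap.smul_apply, smul_eq_mul]; ring

theorem ketbra_smul (a : ℂ) (v : Idx → ℂ) : ketbra (a • v) = (a * star a) • ketbra v := by
  rw [ketbra, star_smul, smul_vecMulVec, vecMulVec_smul, smul_smul, ketbra]

theorem ketbra_mulVec (M : Matrix Idx Idx ℂ) (v : Idx → ℂ) :
    ketbra (M *ᵥ v) = M * ketbra v * Mᴴ := by
  rw [ketbra, ketbra, mul_vecMulVec, vecMulVec_mul, star_mulVec]

theorem trace_ketbra (v : Idx → ℂ) : (ketbra v).trace = star v ⬝ᵥ v := by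
  rw [ketbra, trace_vecMulVec, dotProduct_comm]

theorem star_mulVec_eq_map (M : Matrix Idx Idx ℂ) (v : Idx → ℂ) :
    star (M *ᵥ v) = M.map star *ᵥ star v := by
  ext i; simp [mulVec, dotProduct]

theorem map_star_σy_kronecker : (σy ⊗ₖ σy).map star = σy ⊗ₖ σy := by
  ext i j
  obtain ⟨i, i'⟩ := i
  obtain ⟨j, j'⟩ := j
  fin_cases i <;> fin_cases i' <;> fin_cases j <;> fin_cases j' <;> simp [σy, kroneckerMap_apply]

/-- The conjugate-linear map `v ↦ √ρ (σy ⊗ σy) (√ρ v)*`, whose square is `X(ρ)`. -/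
noncomputable def woottersConj (ρ : State) :
    EuclideanSpace ℂ Idx →ₗ⋆[ℂ] EuclideanSpace ℂ Idx where
  toFun v := WithLp.toLp 2
    (CFC.sqrt ρ.mat *ᵥ ((σy ⊗ₖ σy) *ᵥ star (CFC.sqrt ρ.mat *ᵥ v.ofLp)))
  map_add' v w := by simp [mulVec_add]
  map_smul' c v := by simp [mulVec_smul, star_smul]

theorem rootEigenvalue_nonneg (ρ : State) (k : Fin 4) : 0 ≤ rootEigenvalue ρ k :=
  Real.sqrt_nonneg _

theorem conjTranspose_sqrt (ρ : State) : (CFC.sqrt ρ.mat)ᴴ = CFC.sqrt ρ.mat :=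
  (CFC.sqrt_nonneg ρ.mat).posSemidef.isHermitian

theorem sqrt_mul_sqrt (ρ : State) : CFC.sqrt ρ.mat * CFC.sqrt ρ.mat = ρ.mat :=
  CFC.sqrt_mul_sqrt_self _ ρ.posSemidef.nonneg

/-- This identity transfers the symmetry of the flip form to `woottersConj`, and turns orthonormal
coneigenvectors into flip-orthogonal vectors. -/
theorem inner_woottersConj (ρ : State) (v w : EuclideanSpace ℂ Idx) :
    inner ℂ v (woottersConj ρ w) =
      star (flipForm (CFC.sqrt ρ.mat *ᵥ v.ofLp) (CFC.sqrt ρ.mat *ᵥ w.ofLp)) := by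
  rw [EuclideanSpace.inner_eq_star_dotProduct, dotProduct_comm, ← flipForm_star, flipForm,
    star_mulVec, conjTranspose_sqrt, ← dotProduct_mulVec]
  rfl

theorem woottersConj_woottersConj (ρ : State) (v : EuclideanSpace ℂ Idx) :
    (woottersConj ρ (woottersConj ρ v)).ofLp = wootters ρ.mat *ᵥ v.ofLp := by
  change CFC.sqrt ρ.mat *ᵥ ((σy ⊗ₖ σy) *ᵥ star (CFC.sqrt ρ.mat *ᵥ
    (CFC.sqrt ρ.mat *ᵥ ((σy ⊗ₖ σy) *ᵥ star (CFC.sqrt ρ.mat *ᵥ v.ofLp))))) = _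
  rw [mulVec_mulVec _ (CFC.sqrt ρ.mat) (CFC.sqrt ρ.mat), sqrt_mul_sqrt, star_mulVec_eq_map, star_mulVec_eq_map, star_star,
    map_star_σy_kronecker]
  simp only [wootters, spinFlip, mulVec_mulVec, Matrix.mul_assoc]

theorem sum_ketbra_of_orthonormal {b : Fin 4 → EuclideanSpace ℂ Idx} (hb : Orthonormal ℂ b) :
    ∑ k, ketbra (b k).ofLp = 1 := by
  set U : Matrix Idx (Fin 4) ℂ := Matrix.of fun i k => (b k).ofLp i
  have h1 : Uᴴ * U = 1 := by
    ext k l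
    have := orthonormal_iff_ite.1 hb k l
    rw [EuclideanSpace.inner_eq_star_dotProduct] at this
    rw [one_apply, ← this, Matrix.mul_apply, dotProduct]
    exact Finset.sum_congr rfl fun i _ => mul_comm _ _
  have h2 : U * Uᴴ = 1 := (mul_eq_one_comm_of_card_eq _ _ _ (by simp)).1 h1
  rw [← h2]
  ext i j
  simp [Matrix.sum_apply, Matrix.mul_apply, ketbra, vecMulVec_apply, U]

/-- Wootters' `σy ⊗ σy`-orthogonal decomposition of a state. -/
theorem exists_flip_orthogonal_decomposition (ρ : State) :
    ∃ x : Fin 4 → Idx → ℂ, ∑ k, ketbra (x k) = ρ.mat ∧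
      ∀ k l, flipForm (x k) (x l) = if k = l then (rootEigenvalue ρ k : ℂ) else 0 := by
  obtain ⟨b, s, hb, hs, hJ⟩ := exists_orthonormal_coneigenvectors 4 (by simp) (woottersConj ρ)
    (fun v w => by rw [inner_woottersConj, inner_woottersConj, flipForm_comm])
  -- Sorting `-s` increasingly lists the coneigenvalues in decreasing order, as `rootEigenvalue`
  -- requires.
  set π := Tuple.sort (fun k => -s k)
  have hanti : Antitone (s ∘ π) := fun i j hij => by
    simpa using Tuple.monotone_sort (fun k => -s k) hij
  have hb' : Orthonormal ℂ fun k => b (π k) := hb.comp _ π.injective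
  have hroot : ∀ k, rootEigenvalue ρ k = s (π k) := by
    intro k
    have hli : LinearIndependent ℂ fun k => (b (π k)).ofLp :=
      hb'.linearIndependent.map' (WithLp.linearEquiv 2 ℂ (Idx → ℂ)).toLinearMap
        (LinearEquiv.ker _)
    have hcard : Fintype.card Idx = 4 := by simp
    have key := (isHermitian_wootters ρ).eigenvalues₀_eq_of_eigenbasis
      (b := fun k => (b (π (Fin.cast hcard k))).ofLp)
      (hli.comp _ (Fin.cast_injective hcard))
      (d := fun k => s (π (Fin.cast hcard k)) ^ 2)
      (fun i j hij => pow_le_pow_left₀ (hs _) (hanti (by simpa using hij)) 2)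
      (fun k => by
        rw [← woottersConj_woottersConj, hJ, LinearMap.map_smulₛₗ, hJ, Complex.conj_ofReal,
          smul_smul]
        push_cast
        rw [pow_two]
        rfl)
    rw [rootEigenvalue, key]
    simp [Real.sqrt_sq (hs _)]
  refine ⟨fun k => CFC.sqrt ρ.mat *ᵥ (b (π k)).ofLp, ?_, fun k l => ?_⟩
  · simp_rw [ketbra_mulVec]
    rw [← Finset.sum_mul, ← Finset.mul_sum, sum_ketbra_of_orthonormal hb', mul_one,
      conjTranspose_sqrt, sqrt_mul_sqrt]
  · rw [← star_star (flipForm _ _), ← inner_woottersConj, hJ, inner_smul_right,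
      orthonormal_iff_ite.1 hb', hroot]
    split_ifs with h
    · simp [h]
    · simp

/-- The squared overlaps with a vector only depend on the state. -/
theorem sum_normSq_dotProduct {ι κ : Type*} [Fintype ι] [Fintype κ] {x : ι → Idx → ℂ}
    {y : κ → Idx → ℂ} (h : ∑ k, ketbra (x k) = ∑ i, ketbra (y i)) (g : Idx → ℂ) :
    ∑ k, Complex.normSq (x k ⬝ᵥ g) = ∑ i, Complex.normSq (y i ⬝ᵥ g) := by
  have key : ∀ v : Idx → ℂ, (Complex.normSq (v ⬝ᵥ g) : ℂ) = g ⬝ᵥ (ketbra v *ᵥ star g) := by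
    intro v
    rw [ketbra, vecMulVec_mulVec, dotProduct_smul, ← Complex.mul_conj]
    have : star v ⬝ᵥ star g = star (v ⬝ᵥ g) := by rw [star_dotProduct_star, dotProduct_comm]
    rw [this, dotProduct_comm g v]
    rfl
  apply Complex.ofReal_injective
  push_cast
  simp_rw [key, ← dotProduct_sum, ← sum_mulVec, h]

/-- A vector outside a subspace is separated from it by a linear functional, and every functional
here is a dot product. -/
theorem mem_span_of_dotProduct {ι : Type*} {x : ι → Idx → ℂ} {v : Idx → ℂ}
    (h : ∀ g : Idx → ℂ, (∀ k, x k ⬝ᵥ g = 0) → v ⬝ᵥ g = 0) :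
    v ∈ Submodule.span ℂ (Set.range x) := by
  by_contra hv
  obtain ⟨f, hfv, hf⟩ := Submodule.exists_le_ker_of_notMem hv
  have hdot : ∀ w, f w = w ⬝ᵥ fun j => f (Pi.single j 1) := by
    intro w
    conv_lhs => rw [pi_eq_sum_univ' w]
    simp [dotProduct, map_sum]
  refine hfv ((hdot v).trans (h _ fun k => ?_))
  rw [← hdot]
  exact hf (Submodule.subset_span ⟨k, rfl⟩)

/-- The average concurrence of any ensemble realizing a state is at least the concurrence of the
state. -/
theorem concurrence_le_sum {ι : Type*} [Fintype ι] (ρ : State) {φ : ι → Idx → ℂ}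
    (h : ∑ i, ketbra (φ i) = ρ.mat) : concurrence ρ ≤ ∑ i, ‖flipForm (φ i) (φ i)‖ := by
  refine max_le (Finset.sum_nonneg fun _ _ => norm_nonneg _) ?_
  obtain ⟨x, hx, hflip⟩ := exists_flip_orthogonal_decomposition ρ
  have hsum := fun g => sum_normSq_dotProduct (h.trans hx.symm) g
  have hspan : ∀ i, ∃ a : Fin 4 → ℂ, ∑ k, a k • x k = φ i := by
    intro i
    rw [← Submodule.mem_span_range_iff_exists_fun]
    refine mem_span_of_dotProduct fun g hg => ?_
    have := hsum g
    simp only [hg, map_zero, Finset.sum_const_zero] at this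
    exact Complex.normSq_eq_zero.1
      ((Finset.sum_eq_zero_iff_of_nonneg fun _ _ => Complex.normSq_nonneg _).1 this i
        (Finset.mem_univ i))
  choose a ha using hspan
  have hl : ∀ i k, flipForm (φ i) (x k) = a i k * rootEigenvalue ρ k := by
    intro i k
    rw [← ha, ← flipBilin_apply, map_sum, LinearMap.sum_apply]
    simp [flipBilin_apply, hflip]
  have hself : ∀ i, flipForm (φ i) (φ i) = ∑ k, a i k ^ 2 * rootEigenvalue ρ k := by
    intro i
    nth_rewrite 2 [← ha i]
    rw [← flipBilin_apply, map_sum]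
    simp only [map_smul, flipBilin_apply, hl, smul_eq_mul, ← mul_assoc, pow_two]
  -- Equality of the overlaps with `(σy ⊗ σy) x k` reads `μ_k² ∑ i, |a i k|² = μ_k²`; the factor
  -- `μ_k` covers the case `μ_k = 0`.
  have hone : ∀ k, rootEigenvalue ρ k * ∑ i, ‖a i k‖ ^ 2 = rootEigenvalue ρ k := by
    intro k
    have h1 := hsum ((σy ⊗ₖ σy) *ᵥ x k)
    change ∑ i, Complex.normSq (flipForm (φ i) (x k)) = ∑ l, Complex.normSq (flipForm (x l) (x k))
      at h1
    simp only [hl, hflip, Complex.normSq_mul, Complex.normSq_ofReal] at h1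
    rw [Finset.sum_eq_single k (by intro l _ hl; simp [hl]) (by simp), if_pos rfl,
      Complex.normSq_ofReal, ← Finset.sum_mul] at h1
    simp only [Complex.normSq_eq_norm_sq] at h1
    by_cases hk : rootEigenvalue ρ k = 0
    · rw [hk, zero_mul]
    · have := mul_right_cancel₀ (mul_ne_zero hk hk) (h1.trans (one_mul _).symm)
      rw [this, mul_one]
  have hle : ∀ i, rootEigenvalue ρ 0 * ‖a i 0‖ ^ 2 - rootEigenvalue ρ 1 * ‖a i 1‖ ^ 2 -
      rootEigenvalue ρ 2 * ‖a i 2‖ ^ 2 - rootEigenvalue ρ 3 * ‖a i 3‖ ^ 2 ≤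
      ‖flipForm (φ i) (φ i)‖ := by
    intro i
    have hn : ∀ k, ‖a i k ^ 2 * (rootEigenvalue ρ k : ℂ)‖ = rootEigenvalue ρ k * ‖a i k‖ ^ 2 := by
      intro k
      rw [norm_mul, norm_pow, Complex.norm_real, Real.norm_of_nonneg (rootEigenvalue_nonneg ρ k), mul_comm]
    rw [hself, Fin.sum_univ_four, ← hn, ← hn, ← hn, ← hn]
    set p := a i 0 ^ 2 * (rootEigenvalue ρ 0 : ℂ)
    set q := a i 1 ^ 2 * (rootEigenvalue ρ 1 : ℂ)
    set r := a i 2 ^ 2 * (rootEigenvalue ρ 2 : ℂ)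
    set t := a i 3 ^ 2 * (rootEigenvalue ρ 3 : ℂ)
    have e1 := norm_sub_le_norm_add (p + q + r) t
    have e2 := norm_sub_le_norm_add (p + q) r
    have e3 := norm_sub_le_norm_add p q
    linarith
  refine le_trans (le_of_eq ?_) (Finset.sum_le_sum fun i _ => hle i)
  simp only [Finset.sum_sub_distrib, ← Finset.mul_sum, hone]

/-! ### Decompositions of constant concurrence -/

theorem antitone_rootEigenvalue (ρ : State) : Antitone (rootEigenvalue ρ) := fun i j hij =>
  Real.sqrt_le_sqrt ((isHermitian_wootters ρ).eigenvalues₀_antitone (by simpa using hij))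

/-- Turning the phase from `0` to `π` moves the length continuously from `a + b` down to `a - b`. -/
theorem exists_norm_add_eq {a b r : ℝ} (hb : 0 ≤ b) (hba : b ≤ a) (h1 : a - b ≤ r)
    (h2 : r ≤ a + b) : ∃ u : ℂ, ‖u‖ = 1 ∧ ‖(a : ℂ) + u * b‖ = r := by
  have hcont : Continuous fun t : ℝ => ‖(a : ℂ) + Complex.exp (t * Complex.I) * b‖ := by fun_prop
  have h0 : ‖(a : ℂ) + Complex.exp ((0 : ℝ) * Complex.I) * b‖ = a + b := by
    rw [Complex.ofReal_zero, zero_mul, Complex.exp_zero, one_mul, ← Complex.ofReal_add,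
      Complex.norm_real, Real.norm_of_nonneg (by linarith)]
  have hπ : ‖(a : ℂ) + Complex.exp ((Real.pi : ℝ) * Complex.I) * b‖ = a - b := by
    rw [Complex.exp_pi_mul_I, neg_one_mul, ← sub_eq_add_neg, ← Complex.ofReal_sub,
      Complex.norm_real, Real.norm_of_nonneg (by linarith)]
  obtain ⟨t, -, ht⟩ := intermediate_value_Icc' Real.pi_pos.le hcont.continuousOn
    (show r ∈ _ from ⟨hπ.trans_le h1, h2.trans_eq h0.symm⟩)
  exact ⟨_, Complex.norm_exp_ofReal_mul_I t, ht⟩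

/-- Four lengths none of which exceeds the sum of the others are the sides of a closed polygon. -/
theorem exists_phases_sum_eq_zero {m : Fin 4 → ℝ} (hm : Antitone m) (h0 : ∀ k, 0 ≤ m k)
    (h : m 0 ≤ m 1 + m 2 + m 3) : ∃ u : Fin 4 → ℂ, (∀ k, ‖u k‖ = 1) ∧ ∑ k, u k * m k = 0 := by
  have h10 : m 1 ≤ m 0 := hm (by decide)
  have h21 : m 2 ≤ m 1 := hm (by decide)
  have h32 : m 3 ≤ m 2 := hm (by decide)
  have := h0 1
  have := h0 3
  -- The polygon is cut along a diagonal. This length is the least one that both pairs of sides can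
  -- span; the second pair is then turned against the first.
  obtain ⟨u, hu, hur⟩ := exists_norm_add_eq (r := max (m 0 - m 1) (m 2 - m 3)) (h0 1) h10
    (le_max_left _ _) (max_le (by linarith) (by linarith))
  obtain ⟨v, hv, hvr⟩ := exists_norm_add_eq (r := max (m 0 - m 1) (m 2 - m 3)) (h0 3) h32
    (le_max_right _ _) (max_le (by linarith) (by linarith))
  set p : ℂ := m 0 + u * m 1
  set q : ℂ := m 2 + v * m 3
  obtain ⟨w, hw, hpq⟩ : ∃ w : ℂ, ‖w‖ = 1 ∧ p + w * q = 0 := by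
    by_cases hq : q = 0
    · have hp : p = 0 := by rw [← norm_eq_zero, hur, ← hvr, hq, norm_zero]
      exact ⟨1, norm_one, by rw [hp, hq, mul_zero, add_zero]⟩
    · have hqn : ‖q‖ ≠ 0 := norm_ne_zero_iff.2 hq
      exact ⟨-p / q, by rw [norm_div, norm_neg, hur, ← hvr, div_self hqn],
        by rw [div_mul_cancel₀ _ hq, add_neg_cancel]⟩
  refine ⟨![1, u, w, w * v], ?_, ?_⟩
  · intro k
    fin_cases k <;> simp [hu, hv, hw]
  · rw [Fin.sum_univ_four]
    simp only [cons_val]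
    linear_combination hpq

theorem ketbra_smul_of_norm_eq_one {a : ℂ} (ha : ‖a‖ = 1) (v : Idx → ℂ) :
    ketbra (a • v) = ketbra v := by
  rw [ketbra_smul]
  have : a * star a = 1 := by
    rw [Complex.star_def, Complex.mul_conj, Complex.normSq_eq_norm_sq, ha]; simp
  rw [this, one_smul]

/-- `|v⟩⟨w|` as a real bilinear map. -/
noncomputable def outerBilin : (Idx → ℂ) →ₗ[ℝ] (Idx → ℂ) →ₗ[ℝ] Matrix Idx Idx ℂ :=
  LinearMap.mk₂ ℝ (fun v w => vecMulVec v (star w))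
    (fun _ _ _ => add_vecMulVec _ _ _)
    (fun _ _ _ => smul_vecMulVec _ _ _)
    (fun _ _ _ => by rw [star_add, vecMulVec_add])
    (fun _ _ _ => by rw [star_smul, star_trivial, vecMulVec_smul])

/-- The real part of `flipForm v w - c ⟨v|w⟩`, as a real bilinear map. -/
noncomputable def defectBilin (c : ℝ) : (Idx → ℂ) →ₗ[ℝ] (Idx → ℂ) →ₗ[ℝ] ℝ :=
  LinearMap.mk₂ ℝ (fun v w => (flipForm v w - c * (star v ⬝ᵥ w)).re)
    (fun _ _ _ => by
      simp only [← flipBilin_apply, map_add, LinearMap.add_apply, star_add, add_dotProduct,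
        mul_add, Complex.add_re, Complex.sub_re]; ring)
    (fun r _ _ => by
      rw [star_smul, star_trivial, smul_dotProduct, ← flipBilin_apply,
        LinearMap.map_smul_of_tower, LinearMap.smul_apply, mul_smul_comm, ← smul_sub,
        Complex.smul_re, flipBilin_apply])
    (fun _ _ _ => by
      simp only [← flipBilin_apply, map_add, dotProduct_add,
        mul_add, Complex.add_re, Complex.sub_re]; ring)
    (fun r _ _ => by
      rw [dotProduct_smul, ← flipBilin_apply,
        LinearMap.map_smul_of_tower, mul_smul_comm, ← smul_sub,
        Complex.smul_re, flipBilin_apply])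

/-- `defectBilin` controls only real parts. Real rotations stay in the real span, where the flip
form is real, so nothing is lost. -/
theorem flipForm_im_eq_zero_of_mem_span {ι : Type*} {y : ι → Idx → ℂ}
    (h : ∀ i j, (flipForm (y i) (y j)).im = 0) {v w : Idx → ℂ}
    (hv : v ∈ Submodule.span ℝ (Set.range y)) (hw : w ∈ Submodule.span ℝ (Set.range y)) :
    (flipForm v w).im = 0 := by
  simp only [← flipBilin_apply] at *
  induction hv, hw using Submodule.span_induction₂ with
  | mem_mem v w hv hw =>
    obtain ⟨i, rfl⟩ := hv
    obtain ⟨j, rfl⟩ := hw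
    exact h i j
  | zero_left => simp
  | zero_right => simp
  | add_left _ _ _ _ _ _ h1 h2 => simp [h1, h2]
  | add_right _ _ _ _ _ _ h1 h2 => simp [h1, h2]
  | smul_left _ _ _ _ _ h1 => simp [LinearMap.map_smul_of_tower, h1]
  | smul_right _ _ _ _ _ h1 => simp [LinearMap.map_smul_of_tower, h1]

theorem sum_star_dotProduct (ρ : State) {ι : Type*} [Fintype ι] {z : ι → Idx → ℂ}
    (h : ∑ i, ketbra (z i) = ρ.mat) : ∑ i, star (z i) ⬝ᵥ z i = 1 := by
  simp_rw [← trace_ketbra, ← trace_sum, h, ρ.trace_one]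

/-- The average of four vectors with the signs of a Hadamard matrix. -/
theorem exists_hadamard_mixture (y : Fin 4 → Idx → ℂ) {d : Fin 4 → ℂ}
    (h : ∀ k l, flipForm (y k) (y l) = if k = l then d k else 0) (hd : ∑ k, d k = 0) :
    ∃ z : Fin 4 → Idx → ℂ, ∑ i, ketbra (z i) = ∑ k, ketbra (y k) ∧
      ∀ i, flipForm (z i) (z i) = 0 := by
  -- The sign matrix divided by two is orthogonal, so the mixture is unchanged; each new flip value
  -- is `(∑ k, d k) / 4`.
  refine ⟨![(2⁻¹ : ℝ) • (y 0 + y 1 + y 2 + y 3), (2⁻¹ : ℝ) • (y 0 + y 1 - y 2 - y 3),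
    (2⁻¹ : ℝ) • (y 0 - y 1 + y 2 - y 3), (2⁻¹ : ℝ) • (y 0 - y 1 - y 2 + y 3)], ?_, fun i => ?_⟩
  · have e : ∀ v, ketbra v = outerBilin v v := fun _ => rfl
    simp only [Fin.sum_univ_four, cons_val, e, map_smul, LinearMap.smul_apply, map_add, map_sub,
      LinearMap.add_apply, LinearMap.sub_apply]
    module
  · rw [Fin.sum_univ_four] at hd
    simp only [← flipBilin_apply] at h ⊢
    fin_cases i <;> simp [LinearMap.map_smul_of_tower, h] <;>
      linear_combination hd / 4

/-- Wootters' decomposition of a state into vectors whose concurrence is that of the state. -/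
theorem exists_balanced_decomposition (ρ : State) :
    ∃ z : Fin 4 → Idx → ℂ, ∑ i, ketbra (z i) = ρ.mat ∧
      ∀ i, ‖flipForm (z i) (z i)‖ = concurrence ρ * (star (z i) ⬝ᵥ z i).re := by
  obtain ⟨x, hx, hflip⟩ := exists_flip_orthogonal_decomposition ρ
  set μ := rootEigenvalue ρ with hμ
  by_cases hc : μ 0 - μ 1 - μ 2 - μ 3 ≤ 0
  · have hc0 : concurrence ρ = 0 := max_eq_left hc
    obtain ⟨u, hu, hsum⟩ := exists_phases_sum_eq_zero (antitone_rootEigenvalue ρ)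
      (rootEigenvalue_nonneg ρ) (by linarith)
    -- The flip form is quadratic, so the phases applied to the vectors are square roots of the
    -- polygon's phases.
    choose t ht using fun k => IsAlgClosed.exists_pow_nat_eq (u k) (n := 2) (by norm_num)
    have htn : ∀ k, ‖t k‖ = 1 := by
      intro k
      have := congrArg norm (ht k)
      rw [norm_pow, hu] at this
      exact (pow_eq_one_iff_of_nonneg (norm_nonneg _) two_ne_zero).1 this
    obtain ⟨z, hz, hz0⟩ := exists_hadamard_mixture (fun k => t k • x k) (d := fun k => u k * μ k)
      (fun k l => by
        rw [flipForm_smul_smul, hflip]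
        split_ifs with h
        · rw [← h, ← ht]; ring
        · rw [mul_zero]) hsum
    refine ⟨z, ?_, fun i => by rw [hz0, hc0, norm_zero, zero_mul]⟩
    rw [hz, ← hx]
    exact Finset.sum_congr rfl fun k _ => ketbra_smul_of_norm_eq_one (htn k) _
  · push Not at hc
    have hc0 : concurrence ρ = μ 0 - μ 1 - μ 2 - μ 3 := max_eq_right hc.le
    -- The factor `i` reverses the sign of the last three flip values, so that the four add up to
    -- `C(ρ)`. As `Tr ρ = 1`, the total defect is then zero.
    set ε : Fin 4 → ℂ := ![1, Complex.I, Complex.I, Complex.I]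
    have hε : ∀ k, ‖ε k‖ = 1 := by intro k; fin_cases k <;> simp [ε]
    set y : Fin 4 → Idx → ℂ := fun k => ε k • x k with hy
    have hyρ : ∑ k, ketbra (y k) = ρ.mat := by
      rw [← hx]
      exact Finset.sum_congr rfl fun k _ => ketbra_smul_of_norm_eq_one (hε k) _
    have hyflip : ∀ k l, flipForm (y k) (y l) = if k = l then ε k ^ 2 * μ k else 0 := by
      intro k l
      rw [hy, flipForm_smul_smul, hflip]
      split_ifs with h
      · rw [← h]; ring
      · rw [mul_zero]
    have him : ∀ k l, (flipForm (y k) (y l)).im = 0 := by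
      intro k l
      rw [hyflip]
      split_ifs
      · fin_cases k <;> simp [ε]
      · rfl
    have hQ : ∑ k, defectBilin (concurrence ρ) (y k) (y k) = 0 := by
      change ∑ k, (flipForm (y k) (y k) - concurrence ρ * (star (y k) ⬝ᵥ y k)).re = 0
      rw [← Complex.re_sum, Finset.sum_sub_distrib, ← Finset.mul_sum, sum_star_dotProduct ρ hyρ,
        hc0]
      simp [hyflip, Fin.sum_univ_four, ε]
      ring
    obtain ⟨z, hzspan, hz0, hz⟩ := exists_isotropic_family (defectBilin (concurrence ρ)) outerBilin
      y hQ
    refine ⟨z, hz.trans hyρ, fun i => ?_⟩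
    have h1 : (flipForm (z i) (z i) - concurrence ρ * (star (z i) ⬝ᵥ z i)).re = 0 := hz0 i
    rw [Complex.sub_re, Complex.re_ofReal_mul, sub_eq_zero] at h1
    have h2 := flipForm_im_eq_zero_of_mem_span him (hzspan i) (hzspan i)
    have h3 : flipForm (z i) (z i) = ((concurrence ρ * (star (z i) ⬝ᵥ z i).re : ℝ) : ℂ) :=
      Complex.ext h1 h2
    rw [h3, Complex.norm_real, Real.norm_of_nonneg]
    rw [← corr_one_one]
    exact mul_nonneg (le_max_left _ _) (corr_one_one_nonneg _)

/-! ### The lower bound on the concurrence -/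

theorem trace_ketbra_mul (v : Idx → ℂ) (M : Matrix Idx Idx ℂ) :
    (ketbra v * M).trace = star v ⬝ᵥ (M *ᵥ v) := by
  rw [ketbra, vecMulVec_mul, trace_vecMulVec, dotProduct_comm, ← dotProduct_mulVec]

theorem IsBellValue.eq_sum_chshValue {α : ℝ} {ρ : State} {A₀ A₁ B₀ B₁ : Matrix (Fin 2) (Fin 2) ℂ}
    {S : ℝ} (hS : IsBellValue α ρ A₀ A₁ B₀ B₁ S) {ι : Type*} [Fintype ι] {z : ι → Idx → ℂ}
    (hz : ∑ i, ketbra (z i) = ρ.mat) : S = ∑ i, chshValue α (z i) A₀ A₁ B₀ B₁ := by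
  have h := congrArg Complex.re hS
  rw [← hz, Finset.sum_mul, trace_sum, Complex.re_sum, Complex.ofReal_re] at h
  rw [← h]
  refine Finset.sum_congr rfl fun i _ => ?_
  rw [trace_ketbra_mul, chshOperator]
  simp [chshValue, corr, add_mulVec, sub_mulVec, smul_mulVec, dotProduct_add, dotProduct_sub]

/-- The lower bound on the concurrence in terms of the `α`-CHSH value. -/
theorem sqrt_le_concurrence {α : ℝ} (hα : 1 ≤ α) {ρ : State}
    {A₀ A₁ B₀ B₁ : Matrix (Fin 2) (Fin 2) ℂ} {S : ℝ} (hA₀ : IsObservable A₀)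
    (hA₁ : IsObservable A₁) (hB₀ : IsObservable B₀) (hB₁ : IsObservable B₁)
    (hS : IsBellValue α ρ A₀ A₁ B₀ B₁ S) : √(S ^ 2 / 4 - α ^ 2) ≤ concurrence ρ := by
  have hc : 0 ≤ concurrence ρ := le_max_left _ _
  obtain ⟨z, hz, hbal⟩ := exists_balanced_decomposition ρ
  have hN : ∑ i, corr (z i) 1 1 = 1 := by
    simp_rw [corr_one_one, ← Complex.re_sum, sum_star_dotProduct ρ hz, Complex.one_re]
  have hle : ∀ i, |chshValue α (z i) A₀ A₁ B₀ B₁| ≤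
      2 * √(α ^ 2 + concurrence ρ ^ 2) * corr (z i) 1 1 := by
    intro i
    have hn := corr_one_one_nonneg (z i)
    apply abs_le_of_sq_le_sq _ (by positivity)
    have h1 := sq_chshValue_le hα (z i) hA₀ hA₁ hB₀ hB₁
    rw [Complex.normSq_eq_norm_sq, hbal, ← corr_one_one] at h1
    rw [mul_pow, mul_pow, Real.sq_sqrt (by positivity)]
    linarith
  have habs : |S| ≤ 2 * √(α ^ 2 + concurrence ρ ^ 2) := by
    rw [hS.eq_sum_chshValue hz]
    refine (Finset.abs_sum_le_sum_abs _ _).trans ((Finset.sum_le_sum fun i _ => hle i).trans ?_)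
    rw [← Finset.mul_sum, hN, mul_one]
  have hsq := pow_le_pow_left₀ (abs_nonneg _) habs 2
  rw [sq_abs, mul_pow, Real.sq_sqrt (by positivity)] at hsq
  exact Real.sqrt_le_iff.2 ⟨hc, by linarith⟩

/-! ### The lower bound on the entanglement of formation -/

theorem trace_partialTraceB (M : Matrix Idx Idx ℂ) : (partialTraceB M).trace = M.trace := by
  simp [partialTraceB, Matrix.trace, Fintype.sum_prod_type]

theorem det_partialTraceB_ketbra (v : Idx → ℂ) :
    (partialTraceB (ketbra v)).det = (‖flipForm v v‖ ^ 2 / 4 : ℝ) := by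
  have h : ((‖flipForm v v‖ ^ 2 / 4 : ℝ) : ℂ) = flipForm v v * star (flipForm v v) / 4 := by
    rw [Complex.star_def, Complex.mul_conj, Complex.normSq_eq_norm_sq]
    push_cast
    rfl
  rw [h, flipForm_apply, det_fin_two]
  simp [partialTraceB, ketbra, vecMulVec_apply, Fin.sum_univ_two]
  ring

/-- The eigenvalues of the reduced state have sum `1` and product `C² / 4`, so they are `(1 ± √(1 -
C²)) / 2`. -/
theorem concurrence_le_one_and_pureEntanglement_eq {v : Idx → ℂ} (hv : star v ⬝ᵥ v = 1) :
    ‖flipForm v v‖ ≤ 1 ∧ pureEntanglement v = concurrenceEntropy ‖flipForm v v‖ / Real.log 2 := by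
  have hH := isHermitian_reduced v
  set e := hH.eigenvalues with he
  set C := ‖flipForm v v‖ with hC
  have hsum : e 0 + e 1 = 1 := by
    have h := hH.trace_eq_sum_eigenvalues
    rw [trace_partialTraceB, trace_ketbra, hv, Fin.sum_univ_two] at h
    exact Complex.ofReal_injective (by push_cast at h ⊢; exact h.symm)
  have hprod : e 0 * e 1 = C ^ 2 / 4 := by
    have h := hH.det_eq_prod_eigenvalues
    rw [det_partialTraceB_ketbra, Fin.prod_univ_two] at h
    exact Complex.ofReal_injective (by push_cast at h ⊢; exact h.symm)
  have hdiff : 1 - C ^ 2 = (e 0 - e 1) ^ 2 := by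
    have : (e 0 + e 1) ^ 2 = 1 := by rw [hsum, one_pow]
    linarith
  constructor
  · nlinarith [sq_nonneg (e 0 - e 1), norm_nonneg (flipForm v v)]
  · rw [pureEntanglement, vonNeumannEntropy, Fin.sum_univ_two, concurrenceEntropy, hdiff,
      Real.sqrt_sq_eq_abs]
    congr 1
    have h1 : e 1 = 1 - e 0 := by linarith
    change Real.negMulLog (e 0) + Real.negMulLog (e 1) = _
    rw [h1, ← Real.binEntropy_eq_negMulLog_add_negMulLog_one_sub]
    rcases abs_cases (e 0 - (1 - e 0)) with ⟨h, _⟩ | ⟨h, _⟩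
    · rw [h]
      congr 1
      ring
    · rw [h, ← Real.binEntropy_one_sub]
      congr 1
      ring

/-- The infimum of the empty set of reals is `0`, so bounding the entanglement of formation from
below needs an ensemble to exist. -/
theorem exists_isPureDecomposition (ρ : State) :
    ∃ (p : Fin 4 → ℝ) (ψ : Fin 4 → Idx → ℂ), IsPureDecomposition ρ p ψ := by
  obtain ⟨z, hz, -⟩ := exists_flip_orthogonal_decomposition ρ
  have hunit : ∀ v : Idx → ℂ, ∃ w : Idx → ℂ, star w ⬝ᵥ w = 1 ∧
      ((star v ⬝ᵥ v).re : ℂ) • ketbra w = ketbra v := by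
    intro v
    have hre : star v ⬝ᵥ v = ((star v ⬝ᵥ v).re : ℂ) :=
      Complex.ext rfl (Complex.le_def.1 (dotProduct_star_self_nonneg v)).2.symm
    set N := (star v ⬝ᵥ v).re
    have hN : 0 ≤ N := (corr_one_one_nonneg v).trans_eq (corr_one_one v)
    by_cases hv : v = 0
    · refine ⟨Pi.single (0, 0) 1, by simp, ?_⟩
      rw [← hre, hv]
      simp [ketbra]
    · have hN0 : (N : ℂ) ≠ 0 := by
        rw [← hre]
        exact fun h => hv (dotProduct_star_self_eq_zero.1 h)
      have hsq : ((√N)⁻¹ : ℂ) * ((√N)⁻¹ : ℂ) = (N : ℂ)⁻¹ := by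
        rw [← mul_inv, ← Complex.ofReal_mul, Real.mul_self_sqrt hN]
      have hstar : star ((√N)⁻¹ : ℂ) = (√N : ℂ)⁻¹ := by simp
      refine ⟨((√N)⁻¹ : ℂ) • v, ?_, ?_⟩
      · rw [star_smul, smul_dotProduct, dotProduct_smul, hre, smul_smul, hstar, hsq, smul_eq_mul,
          inv_mul_cancel₀ hN0]
      · rw [ketbra_smul, hstar, hsq, smul_smul, mul_inv_cancel₀ hN0, one_smul]
  choose ψ hψ hψz using fun k => hunit (z k)
  refine ⟨fun k => (star (z k) ⬝ᵥ z k).re, ψ, fun k => ?_, ?_, hψ, ?_⟩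
  · exact (corr_one_one_nonneg _).trans_eq (corr_one_one _)
  · rw [← Complex.re_sum, sum_star_dotProduct ρ hz, Complex.one_re]
  · simp_rw [hψz, hz]

/-- The entanglement of formation dominates the entropy function of any lower bound on the
concurrence. -/
theorem le_entanglementOfFormation {ρ : State} {x : ℝ} (hx : 0 ≤ x) (hxc : x ≤ concurrence ρ) :
    concurrenceEntropy x / Real.log 2 ≤ entanglementOfFormation ρ := by
  apply le_csInf
  · obtain ⟨p, ψ, h⟩ := exists_isPureDecomposition ρ
    exact ⟨_, 4, p, ψ, h, rfl⟩
  rintro e ⟨n, p, ψ, ⟨hp, hp1, hψ, hρ⟩, rfl⟩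
  have hmem : ∀ i, ‖flipForm (ψ i) (ψ i)‖ ∈ Set.Icc (0 : ℝ) 1 := fun i =>
    ⟨norm_nonneg _, (concurrence_le_one_and_pureEntanglement_eq (hψ i)).1⟩
  have hsq : ∀ i, ((√(p i) : ℂ)) * (√(p i) : ℂ) = p i := fun i => by
    rw [← Complex.ofReal_mul, Real.mul_self_sqrt (hp i)]
  have havg : concurrence ρ ≤ ∑ i, p i * ‖flipForm (ψ i) (ψ i)‖ := by
    refine (concurrence_le_sum ρ (φ := fun i => (√(p i) : ℂ) • ψ i) ?_).trans_eq ?_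
    · rw [hρ]
      refine Finset.sum_congr rfl fun i _ => ?_
      rw [ketbra_smul, Complex.star_def, Complex.conj_ofReal, hsq]
    · refine Finset.sum_congr rfl fun i _ => ?_
      rw [flipForm_smul_smul, hsq, norm_mul, Complex.norm_real, Real.norm_of_nonneg (hp i)]
  have hconv := convexOn_concurrenceEntropy.map_sum_le (t := Finset.univ) (fun i _ => hp i) hp1
    (fun i _ => hmem i)
  have havg1 := (convex_Icc (0 : ℝ) 1).sum_mem (t := Finset.univ) (fun i _ => hp i) hp1
    (fun i _ => hmem i)
  simp only [smul_eq_mul] at hconv havg1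
  have hle := hxc.trans havg
  have hmono := monotoneOn_concurrenceEntropy ⟨hx, hle.trans havg1.2⟩ havg1 hle
  have hE : ∑ i, p i * pureEntanglement (ψ i) =
      (∑ i, p i * concurrenceEntropy ‖flipForm (ψ i) (ψ i)‖) / Real.log 2 := by
    rw [Finset.sum_div]
    refine Finset.sum_congr rfl fun i _ => ?_
    rw [(concurrence_le_one_and_pureEntanglement_eq (hψ i)).2, mul_div_assoc]
  rw [hE]
  exact div_le_div_of_nonneg_right (hmono.trans hconv) (Real.log_nonneg (by norm_num))

/-! ### Bell-diagonal states attaining the bound -/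

theorem isObservable_cos_sin {c s : ℝ} (h : c ^ 2 + s ^ 2 = 1) :
    IsObservable ((c : ℂ) • σz + (s : ℂ) • σx) := by
  have h' : (c : ℂ) * c + s * s = 1 := by rw [← pow_two, ← pow_two]; exact_mod_cast h
  constructor
  · ext i j
    fin_cases i <;> fin_cases j <;> simp [σz, σx]
  · ext i j
    fin_cases i <;> fin_cases j <;> simp [σz, σx, Matrix.mul_apply, Fin.sum_univ_two] <;>
      first | linear_combination h' | ring1

theorem inv_sqrt_two_mul_self : ((√2 : ℝ) : ℂ)⁻¹ * ((√2 : ℝ) : ℂ)⁻¹ = 1 / 2 := by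
  rw [← mul_inv, ← Complex.ofReal_mul, Real.mul_self_sqrt (by norm_num)]
  norm_num

theorem bellDiagonal_two_apply (l₁ l₂ : ℝ) (i j : Idx) : bellDiagonal l₁ l₂ 0 0 i j =
    if i.1 = i.2 ∧ j.1 = j.2 then (if i = j then ((l₁ + l₂) / 2 : ℂ) else (l₁ - l₂) / 2)
      else 0 := by
  have h := inv_sqrt_two_mul_self
  obtain ⟨i, i'⟩ := i
  obtain ⟨j, j'⟩ := j
  fin_cases i <;> fin_cases i' <;> fin_cases j <;> fin_cases j' <;>
    simp [bellDiagonal, ketbra, vecMulVec_apply, Φplus, Φminus] <;>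
    (simp only [h]; try ring)

/-- Spin flip fixes each Bell vector up to a phase. Hence `X(ρ) = ρ²`, and the root eigenvalues are
the eigenvalues of the state. -/
theorem spinFlip_bellDiagonal_two (l₁ l₂ : ℝ) :
    spinFlip (bellDiagonal l₁ l₂ 0 0) = bellDiagonal l₁ l₂ 0 0 := by
  ext i j
  obtain ⟨i, i'⟩ := i
  obtain ⟨j, j'⟩ := j
  fin_cases i <;> fin_cases i' <;> fin_cases j <;> fin_cases j' <;>
    simp [spinFlip, Matrix.mul_apply, Fintype.sum_prod_type, Fin.sum_univ_two, kroneckerMap_apply,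
      σy, bellDiagonal_two_apply, Complex.conj_ofNat]

theorem trace_bellDiagonal_two (l₁ l₂ : ℝ) : (bellDiagonal l₁ l₂ 0 0).trace = l₁ + l₂ := by
  simp [Matrix.trace, Fintype.sum_prod_type, bellDiagonal_two_apply]
  ring

theorem posSemidef_bellDiagonal {l₁ l₂ l₃ l₄ : ℝ} (h₁ : 0 ≤ l₁) (h₂ : 0 ≤ l₂) (h₃ : 0 ≤ l₃)
    (h₄ : 0 ≤ l₄) : (bellDiagonal l₁ l₂ l₃ l₄).PosSemidef := by
  have h : ∀ (v : Idx → ℂ) {l : ℝ}, 0 ≤ l → ((l : ℂ) • ketbra v).PosSemidef := fun v l hl =>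
    (posSemidef_vecMulVec_self_star v).smul (Complex.zero_le_real.2 hl)
  exact (((h _ h₁).add (h _ h₂)).add (h _ h₃)).add (h _ h₄)

theorem wootters_bellDiagonal_two {l₁ l₂ : ℝ} (h₁ : 0 ≤ l₁) (h₂ : 0 ≤ l₂) :
    wootters (bellDiagonal l₁ l₂ 0 0) = bellDiagonal l₁ l₂ 0 0 * bellDiagonal l₁ l₂ 0 0 := by
  have h := CFC.sqrt_mul_sqrt_self _ (posSemidef_bellDiagonal h₁ h₂ le_rfl le_rfl).nonneg
  rw [wootters, spinFlip_bellDiagonal_two]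
  set R := CFC.sqrt (bellDiagonal l₁ l₂ 0 0)
  rw [← h]
  simp only [Matrix.mul_assoc]

theorem bellDiagonal_two_mulVec (l₁ l₂ : ℝ) (v : Idx → ℂ) : bellDiagonal l₁ l₂ 0 0 *ᵥ v =
    fun i => if i.1 = i.2 then (if i.1 = 0 then ((l₁ + l₂) / 2 * v (0, 0) + (l₁ - l₂) / 2 * v (1, 1))
      else ((l₁ - l₂) / 2 * v (0, 0) + (l₁ + l₂) / 2 * v (1, 1))) else (0 : ℂ) := by
  ext i
  obtain ⟨i, i'⟩ := i
  fin_cases i <;> fin_cases i' <;>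
    simp [mulVec, dotProduct, Fintype.sum_prod_type, Fin.sum_univ_two, bellDiagonal_two_apply]

/-- Multiples of the Bell vectors `Φ⁺, Φ⁻`, completed to an orthogonal basis. -/
def bellFamily : Fin 4 → Idx → ℂ :=
  ![Pi.single (0, 0) 1 + Pi.single (1, 1) 1, Pi.single (0, 0) 1 - Pi.single (1, 1) 1,
    Pi.single (0, 1) 1, Pi.single (1, 0) 1]

theorem linearIndependent_bellFamily : LinearIndependent ℂ bellFamily := by
  rw [Fintype.linearIndependent_iff]
  intro g hg
  have h : ∀ i, (∑ k, g k • bellFamily k) i = 0 := fun i => by rw [hg]; rfl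
  have h00 := h (0, 0)
  have h01 := h (0, 1)
  have h10 := h (1, 0)
  have h11 := h (1, 1)
  simp [Fin.sum_univ_four, bellFamily] at h00 h01 h10 h11
  intro k
  fin_cases k
  · change g 0 = 0
    linear_combination (h00 + h11) / 2
  · change g 1 = 0
    linear_combination (h00 - h11) / 2
  · exact h01
  · exact h10

theorem bellDiagonal_two_mulVec_bellFamily (l₁ l₂ : ℝ) (k : Fin 4) :
    bellDiagonal l₁ l₂ 0 0 *ᵥ bellFamily k = ((![l₁, l₂, 0, 0] k : ℝ) : ℂ) • bellFamily k := by
  rw [bellDiagonal_two_mulVec]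
  ext i
  obtain ⟨i, i'⟩ := i
  fin_cases k <;> fin_cases i <;> fin_cases i' <;> simp [bellFamily] <;> ring

theorem concurrence_of_mat_eq_bellDiagonal {ρ : State} {l₁ l₂ : ℝ} (h₂ : 0 ≤ l₂) (h₂₁ : l₂ ≤ l₁)
    (hρ : ρ.mat = bellDiagonal l₁ l₂ 0 0) : concurrence ρ = l₁ - l₂ := by
  have hl : ∀ k, 0 ≤ ![l₁, l₂, 0, 0] k := by
    intro k
    fin_cases k <;> simp <;> linarith
  have hanti : Antitone ![l₁, l₂, 0, 0] := by
    apply Fin.antitone_iff_succ_le.2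
    intro k
    fin_cases k <;> simp [h₂, h₂₁]
  have hcard : Fintype.card Idx = 4 := by simp
  have hroot : ∀ k, rootEigenvalue ρ k = ![l₁, l₂, 0, 0] k := by
    intro k
    have key := (isHermitian_wootters ρ).eigenvalues₀_eq_of_eigenbasis
      (b := fun k => bellFamily (Fin.cast hcard k))
      (linearIndependent_bellFamily.comp _ (Fin.cast_injective hcard))
      (d := fun k => ![l₁, l₂, 0, 0] (Fin.cast hcard k) ^ 2)
      (fun i j hij => pow_le_pow_left₀ (hl _) (hanti (by simpa using hij)) 2)
      (fun k => by
        rw [hρ, wootters_bellDiagonal_two (h₂.trans h₂₁) h₂, ← mulVec_mulVec,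
          bellDiagonal_two_mulVec_bellFamily, mulVec_smul, bellDiagonal_two_mulVec_bellFamily,
          smul_smul]
        push_cast
        rw [pow_two])
    rw [rootEigenvalue, key]
    exact Real.sqrt_sq (hl k)
  rw [concurrence, hroot, hroot, hroot, hroot]
  simp [h₂₁]

/-- The correlation of `σz ⊗ σz` is `l₁ + l₂ = 1`, that of `σx ⊗ σx` is `l₁ - l₂`, and the mixed
ones vanish. -/
theorem isBellValue_bellDiagonal_two {α l₁ l₂ c s : ℝ} {ρ : State} (hl : l₁ + l₂ = 1)
    (hρ : ρ.mat = bellDiagonal l₁ l₂ 0 0) :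
    IsBellValue α ρ σz σx ((c : ℂ) • σz + (s : ℂ) • σx) ((c : ℂ) • σz - (s : ℂ) • σx)
      (2 * (α * c + (l₁ - l₂) * s)) := by
  have hl' : (l₁ : ℂ) + l₂ = 1 := by exact_mod_cast hl
  rw [IsBellValue, hρ, chshOperator]
  simp [Matrix.trace, Matrix.mul_apply, Fintype.sum_prod_type, Fin.sum_univ_two,
    bellDiagonal_two_apply, kroneckerMap_apply, σz, σx]
  linear_combination (2 * α * c : ℂ) * hl'

/-- The measurement angle at which the Bell-diagonal state has the largest `α`-CHSH value. -/
theorem two_mul_cos_add_sin_arctan {α t S : ℝ} (hα : 0 < α) (hS : 0 < S)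
    (h : α ^ 2 + t ^ 2 = S ^ 2 / 4) :
    2 * (α * Real.cos (Real.arctan (1 / α * t)) + t * Real.sin (Real.arctan (1 / α * t))) = S := by
  have hsqrt : √(1 + (1 / α * t) ^ 2) = S / (2 * α) := by
    rw [Real.sqrt_eq_iff_mul_self_eq_of_pos (by positivity)]
    field_simp
    linarith
  rw [Real.cos_arctan, Real.sin_arctan, hsqrt]
  field_simp
  linarith

theorem exists_state_attaining {α S : ℝ} (hα : 1 ≤ α) (h₁ : 2 * α ≤ S)
    (h₂ : S ≤ 2 * √(1 + α ^ 2)) :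
    ∃ ρ : State,
      ρ.mat = bellDiagonal (1 / 2 + 1 / 2 * √(S ^ 2 / 4 - α ^ 2))
        (1 / 2 - 1 / 2 * √(S ^ 2 / 4 - α ^ 2)) 0 0 ∧
      ∃ θ : ℝ, θ = Real.arctan (1 / α * √(S ^ 2 / 4 - α ^ 2)) ∧
        IsObservable σz ∧ IsObservable σx ∧
        IsObservable ((Real.cos θ : ℂ) • σz + (Real.sin θ : ℂ) • σx) ∧
        IsObservable ((Real.cos θ : ℂ) • σz - (Real.sin θ : ℂ) • σx) ∧
        IsBellValue α ρ σz σx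
          ((Real.cos θ : ℂ) • σz + (Real.sin θ : ℂ) • σx)
          ((Real.cos θ : ℂ) • σz - (Real.sin θ : ℂ) • σx) S ∧
        concurrence ρ = √(S ^ 2 / 4 - α ^ 2) := by
  have hS : 0 < S := by linarith
  have hpos : 0 ≤ S ^ 2 / 4 - α ^ 2 := by nlinarith
  -- The upper limit on `S` amounts to `t ≤ 1`, that is, to `λ₂ ≥ 0`.
  have hsq := pow_le_pow_left₀ hS.le h₂ 2
  rw [mul_pow, Real.sq_sqrt (by positivity)] at hsq
  have ht2 := Real.sq_sqrt hpos
  have ht1 : √(S ^ 2 / 4 - α ^ 2) ≤ 1 := Real.sqrt_le_one.2 (by linarith)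
  have ht0 := Real.sqrt_nonneg (S ^ 2 / 4 - α ^ 2)
  set t := √(S ^ 2 / 4 - α ^ 2)
  let ρ : State :=
    { mat := bellDiagonal (1 / 2 + 1 / 2 * t) (1 / 2 - 1 / 2 * t) 0 0
      posSemidef := posSemidef_bellDiagonal (by linarith) (by linarith) le_rfl le_rfl
      trace_one := by
        rw [trace_bellDiagonal_two]
        push_cast
        ring }
  refine ⟨ρ, rfl, _, rfl, ?_, ?_, isObservable_cos_sin (Real.cos_sq_add_sin_sq _), ?_, ?_, ?_⟩
  · simpa using isObservable_cos_sin (c := 1) (s := 0) (by norm_num)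
  · simpa using isObservable_cos_sin (c := 0) (s := 1) (by norm_num)
  · have := isObservable_cos_sin (c := Real.cos (Real.arctan (1 / α * t)))
      (s := -Real.sin (Real.arctan (1 / α * t))) (by rw [neg_sq]; exact Real.cos_sq_add_sin_sq _)
    rwa [Complex.ofReal_neg, neg_smul, ← sub_eq_add_neg] at this
  · have := isBellValue_bellDiagonal_two (α := α) (c := Real.cos (Real.arctan (1 / α * t)))
      (s := Real.sin (Real.arctan (1 / α * t))) (ρ := ρ) (by ring) rfl
    have hS' := two_mul_cos_add_sin_arctan (by linarith) hS
      (show α ^ 2 + t ^ 2 = S ^ 2 / 4 by linarith)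
    rw [show 1 / 2 + 1 / 2 * t - (1 / 2 - 1 / 2 * t) = t by ring, hS'] at this
    exact this
  · rw [concurrence_of_mat_eq_bellDiagonal (ρ := ρ) (by linarith) (by linarith) rfl]
    ring

end QubitPair

/-! ### Assembling the theorem -/

open QubitPair in
theorem theorem1 (α : ℝ) (hα : 1 ≤ α) :
    -- the lower bounds, for all states and all observables
    (∀ (ρ : State) (A₀ A₁ B₀ B₁ : Matrix (Fin 2) (Fin 2) ℂ) (S : ℝ),
      IsObservable A₀ → IsObservable A₁ → IsObservable B₀ → IsObservable B₁ →
      IsBellValue α ρ A₀ A₁ B₀ B₁ S →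
        √(S ^ 2 / 4 - α ^ 2) ≤ concurrence ρ ∧
        (2 * α ≤ |S| →
          binaryEntropy (1 / 2 + 1 / 2 * √(1 + α ^ 2 - S ^ 2 / 4)) ≤
            entanglementOfFormation ρ)) ∧
    -- the bound on the concurrence is attained
    (∀ S : ℝ, 2 * α ≤ S → S ≤ 2 * √(1 + α ^ 2) →
      ∃ ρ : State,
        ρ.mat = bellDiagonal (1 / 2 + 1 / 2 * √(S ^ 2 / 4 - α ^ 2))
          (1 / 2 - 1 / 2 * √(S ^ 2 / 4 - α ^ 2)) 0 0 ∧
        ∃ θ : ℝ, θ = Real.arctan (1 / α * √(S ^ 2 / 4 - α ^ 2)) ∧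
          IsObservable σz ∧ IsObservable σx ∧
          IsObservable ((Real.cos θ : ℂ) • σz + (Real.sin θ : ℂ) • σx) ∧
          IsObservable ((Real.cos θ : ℂ) • σz - (Real.sin θ : ℂ) • σx) ∧
          IsBellValue α ρ σz σx
            ((Real.cos θ : ℂ) • σz + (Real.sin θ : ℂ) • σx)
            ((Real.cos θ : ℂ) • σz - (Real.sin θ : ℂ) • σx) S ∧
          concurrence ρ = √(S ^ 2 / 4 - α ^ 2)) := by
  refine ⟨fun ρ A₀ A₁ B₀ B₁ S hA₀ hA₁ hB₀ hB₁ hS => ?_, fun S => exists_state_attaining hα⟩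
  have hC := sqrt_le_concurrence hα hA₀ hA₁ hB₀ hB₁ hS
  refine ⟨hC, fun habs => ?_⟩
  -- For `|S| ≥ 2 α` the real square root is not truncated to zero, so squaring it recovers its
  -- argument inside the entropy.
  have hpos : 0 ≤ S ^ 2 / 4 - α ^ 2 := by
    have := pow_le_pow_left₀ (by linarith) habs 2
    rw [sq_abs] at this
    linarith
  have h := le_entanglementOfFormation (Real.sqrt_nonneg _) hC
  rw [concurrenceEntropy, Real.sq_sqrt hpos] at h
  rw [binaryEntropy, show 1 + α ^ 2 - S ^ 2 / 4 = 1 - (S ^ 2 / 4 - α ^ 2) by ring]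
  exact h
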